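/- Let $q$ be a prime power, let $k\ge 2$, and let $R=M_{k\times k}(\mathbb F_q)$ with group of units $\mathcal U=GL(k,\mathbb F_q)$. Let $w:R\to\mathbb Z$ satisfy $w(0)=0$ and $w(r)>0$ for $r\neq 0$, and suppose that $w$ has maximal symmetry, i.e. $w(ur)=w(r)=w(ru)$ for all $r\in R$, $u\in\mathcal U$. Then $w(r)$ depends only on the rank of $r$; write $w_i$ for the value of $w$ on matrices of rank $i$. Assume that $w$ is nondegenerate, i.e. that $$c_j=(-1)^j q^{\binom j2}\sum_{\ell=0}^{j}(-1)^\ell q^{\binom \ell2}\begin{bmatrix} j\\ \ell\end{bmatrix}_q w_\ell\neq 0\qquad (j=1,\dots,k),$$ where $\begin{bmatrix} j\\ \ell\end{bmatrix}_q$ is the $q$-binomial coefficient. Put $\mathring w=\min\{w(r):r\ne0\}=\min\{w_1,\dots,w_k\}$, $I_d=\{i\in\{1,\dots,k\}: w_i=d\}$ and $\mathring I=I_{\mathring w}$. For $v\in R^n$ put $w(v)=\sum_{i=1}^n w(v_i)$. A linear code of length $n$ over $R$ is a left $R$-submodule $C\subseteq R^n$; its dual code is $C^\perp=\{y\in R^n:\sum_{i=1}^n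 x_iy_i=0\text{ for all }x\in C\}$. For $C\subseteq R^n$, let $A_j(C)=|\{x\in C:w(x)=j\}|$ and $\mathrm{wwe}_C(X,Y)=\sum_{x\in C}X^{n w_{\max}-w(x)}Y^{w(x)}$, where $w_{\max}$ is the largest value of $w$. One says that $w$ respects duality if, for every $n\ge1$ and all linear codes $C,D\subseteq R^n$, $\mathrm{wwe}_C=\mathrm{wwe}_D$ implies $\mathrm{wwe}_{C^\perp}=\mathrm{wwe}_{D^\perp}$. **Theorem.** Suppose that there is an integer $d$ such that $\mathring w\le d<2\mathring w$, $I_d$ is nonempty, and $k\notin I_d$. Then $w$ does not respect duality: there exist linear codes $C$ and $D$ over $R$ of the same length such that $\mathrm{wwe}_C=\mathrm{wwe}_D$ and $A_d(C^\perp)\neq A_d(D^\perp)$. In particular, if $k\notin\mathring I$, then $w$ does not respect duality. -/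

import Mathlib

namespace RingCode

/-! Weights and linear codes over a finite ring. -/

section General

variable {R : Type*} [Ring R]

/-- `w` is a weight with positive integer values: `w 0 = 0` and `w r` is a positive integer
for every `r ≠ 0`. -/
def IsPositiveWeight (w : R → ℕ) : Prop :=
  w 0 = 0 ∧ ∀ r, r ≠ 0 → 0 < w r

/-- The left symmetry group `{u ∈ 𝒰 : w (u r) = w r for all r}`. -/
def leftSymmetry (w : R → ℕ) : Subgroup Rˣ where
  carrier := {u | ∀ r : R, w ((u : R) * r) = w r}
  one_mem' := by intro r; simp
  mul_mem' := by
    intro u v hu hv r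
    rw [Units.val_mul, mul_assoc, hu, hv]
  inv_mem' := by
    intro u hu r
    rw [← hu ((u⁻¹ : Rˣ) * r), Units.mul_inv_cancel_left]

/-- The right symmetry group `{u ∈ 𝒰 : w (r u) = w r for all r}`. -/
def rightSymmetry (w : R → ℕ) : Subgroup Rˣ where
  carrier := {u | ∀ r : R, w (r * (u : R)) = w r}
  one_mem' := by intro r; simp
  mul_mem' := by
    intro u v hu hv r
    rw [Units.val_mul, ← mul_assoc, hv, hu]
  inv_mem' := by
    intro u hu r
    rw [← hu (r * (u⁻¹ : Rˣ)), Units.inv_mul_cancel_right]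

/-- Maximal symmetry: both symmetry groups are the full group of units. -/
def HasMaximalSymmetry (w : R → ℕ) : Prop :=
  leftSymmetry w = ⊤ ∧ rightSymmetry w = ⊤

/-- The additive extension of `w` to vectors. -/
def wt (w : R → ℕ) {n : ℕ} (v : Fin n → R) : ℕ := ∑ i, w (v i)

/-- The smallest weight of a nonzero ring element. -/
noncomputable def minWeight (w : R → ℕ) : ℕ := sInf (w '' {r | r ≠ 0})

/-- The largest value of `w`. -/
def maxWeight [Fintype R] (w : R → ℕ) : ℕ := Finset.univ.sup w

/-- The number `A_j` of vectors of weight `j` in a code. -/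
noncomputable def weightCount (w : R → ℕ) {n : ℕ} (C : Set (Fin n → R)) (j : ℕ) : ℕ :=
  Set.ncard {x | x ∈ C ∧ wt w x = j}

open Classical in
/-- The `w`-weight enumerator `∑_{x ∈ C} X^(n w_max - w(x)) Y^(w(x))`, where `X`, `Y` are the
variables of index `0`, `1`. The subtraction of natural numbers is a true one, because
`w(x) ≤ n w_max`. -/
noncomputable def weightEnumerator [Fintype R] (w : R → ℕ) {n : ℕ} (C : Set (Fin n → R)) :
    MvPolynomial (Fin 2) ℤ :=
  ∑ x with x ∈ C,
    MvPolynomial.X 0 ^ (n * maxWeight w - wt w x) * MvPolynomial.X 1 ^ wt w x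

/-- The right dual code `{y : x · y = 0 for all x ∈ C}` of a left linear code `C`, where
`x · y = ∑ i, x i * y i`; it is a right linear code. -/
def dualCode {n : ℕ} (C : Submodule R (Fin n → R)) : Submodule Rᵐᵒᵖ (Fin n → R) where
  carrier := {y | ∀ x ∈ C, x ⬝ᵥ y = 0}
  add_mem' := by
    intro a b ha hb x hx
    rw [dotProduct_add, ha x hx, hb x hx, add_zero]
  zero_mem' := by intro x _; simp
  smul_mem' := by
    intro c y hy x hx
    rw [dotProduct_smul, hy x hx, smul_zero]

/-- `w` respects duality: for left linear codes of the same length `n ≥ 1`, equality of the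
`w`-weight enumerators implies equality of the `w`-weight enumerators of the dual codes. -/
def RespectsDuality [Fintype R] (w : R → ℕ) : Prop :=
  ∀ n : ℕ, 1 ≤ n → ∀ C D : Submodule R (Fin n → R),
    weightEnumerator w (C : Set (Fin n → R)) = weightEnumerator w (D : Set (Fin n → R)) →
      weightEnumerator w (dualCode C : Set (Fin n → R)) =
        weightEnumerator w (dualCode D : Set (Fin n → R))

end General

/-! Weights on the ring of `k × k` matrices over a finite field. -/

section MatrixRing

/-- The `q`-binomial coefficient
`((q^m - 1) ⋯ (q^(m-j+1) - 1)) / ((q^j - 1) ⋯ (q - 1))`, for `q ≥ 2`; it is `0` for `j > m`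
because of the factor `q^(m-m) - 1`. -/
def qBinomial (q m j : ℕ) : ℚ :=
  (∏ i ∈ Finset.range j, ((q : ℚ) ^ (m - i) - 1)) /
    ∏ i ∈ Finset.range j, ((q : ℚ) ^ (i + 1) - 1)

variable {F : Type*} [Field F] {k : ℕ}

/-- The value `w_l` of `w` at the matrix of rank `l` with block form `[I_l, 0; 0, 0]`
(for `l ≤ k`). If `w` has maximal symmetry, then this is the common value of `w` on all
matrices of rank `l`. -/
def rankValue (w : Matrix (Fin k) (Fin k) F → ℕ) (l : ℕ) : ℕ :=
  w (Matrix.diagonal fun i : Fin k => if (i : ℕ) < l then 1 else 0)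

/-- `c_j = (-1)^j q^(j choose 2) ∑_{l=0}^{j} (-1)^l q^(l choose 2) [j, l]_q w_l`, where `q` is the
number of elements of the field. -/
def diagCoeff [Fintype F] (w : Matrix (Fin k) (Fin k) F → ℕ) (j : ℕ) : ℚ :=
  (-1) ^ j * (Fintype.card F : ℚ) ^ (j.choose 2) *
    ∑ l ∈ Finset.range (j + 1),
      (-1) ^ l * (Fintype.card F : ℚ) ^ (l.choose 2) * qBinomial (Fintype.card F) j l *
        (rankValue w l : ℚ)

/-- `w` is nondegenerate: `c_1, …, c_k` are all nonzero. -/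
def IsNondegenerate [Fintype F] (w : Matrix (Fin k) (Fin k) F → ℕ) : Prop :=
  ∀ j ∈ Finset.Icc 1 k, diagCoeff w j ≠ 0

/-- The set `I_d = {i ∈ {1, …, k} : w_i = d}`. -/
def rankSet (w : Matrix (Fin k) (Fin k) F → ℕ) (d : ℕ) : Set ℕ :=
  {i | 1 ≤ i ∧ i ≤ k ∧ rankValue w i = d}

end MatrixRing

end RingCode

open RingCode

namespace RingCode
open Module

set_option linter.unusedSectionVars false

/-! ### Möbius sums over the lattice of subspaces -/

section Subspaces

variable {F : Type*} [Field F] [Fintype F]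

/-! Suppose that no pair of codes separates at `d`. A code is described by multiplicities `a l` of
its columns `l`, which are `m × k` matrices; the codeword of a `k × m` matrix `x` has weight `∑ l, a
l * w (x * l)`. Since `d < 2 * minWeight w`, dual words of weight `d` have a single nonzero entry,
so `A_d` of the dual is linear in `a`. Zero columns equalize lengths without changing weights, and
multiplicities can be scaled, so the assumption becomes: positive rational multiplicities with the
same multiset of weights have the same total `survivorCount`.

Nondegeneracy permits Möbius inversion on subspaces: the indicator of the matrices with a given
proper kernel `K` is a combination `ε K` of the functions `x ↦ w (x * l)`
(`exists_sum_mul_eq_ite_ker`). Perturb multiplicities whose weight is constant on the fibres of `K`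
and of suitable hyperplanes `S i`, by `ε K` or by `∑ i, ε (S i)`. If the fibre sizes match, the
multisets of weights agree, so the survivor functional `G` satisfies `G K = ∑ i, G (S i)`
(`sum_survivorCount_eq_sum_of_independent`). Every fibre size is a multiple of that of a hyperplane,
so for large `m` `G` is proportional to fibre size, whence `survivorCount w d l = c * ∑ x, w (x *
l)` for all `l` (`exists_survivorCount_eq_mul_sum`).

Now take the Möbius sum of both sides over the subspaces of `F^k`. On the left only invertible
matrices of weight `d` contribute, and there are none because `k ∉ I_d`. On the right stands `c`
times a nonzero number, so `c = 0`. Then no matrix of weight `d` survives, although an injective `l`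
kills none of them and `I_d` is nonempty. -/

noncomputable instance submoduleFintype (V : Type*) [AddCommGroup V] [Module F V] [Finite V] :
    Fintype (Submodule F V) := Fintype.ofFinite _

/-- The value of the Möbius function of the subspace lattice on an interval of length `d`. -/
def mobiusValue (q d : ℕ) : ℚ := (-1) ^ d * (q : ℚ) ^ (d.choose 2)

lemma mobiusValue_succ (q d : ℕ) :
    mobiusValue q (d + 1) = -((q : ℚ) ^ d * mobiusValue q d) := by
  simp only [mobiusValue, Nat.choose_succ_succ' d 1, Nat.choose_one_right, pow_add, pow_succ]
  ring

lemma mobiusValue_ne_zero {q : ℕ} (hq : q ≠ 0) (d : ℕ) : mobiusValue q d ≠ 0 := by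
  simp [mobiusValue, hq]

lemma qBinomial_succ_succ {q : ℕ} (hq : 2 ≤ q) {m j : ℕ} (h : j ≤ m) :
    qBinomial q (m + 1) (j + 1) = qBinomial q m j + (q : ℚ) ^ (j + 1) * qBinomial q m (j + 1) := by
  have hne : ∀ i : ℕ, (q : ℚ) ^ (i + 1) - 1 ≠ 0 := fun i => by
    have : (1 : ℚ) < (q : ℚ) ^ (i + 1) := one_lt_pow₀ (by exact_mod_cast hq) (by omega)
    linarith
  have hD : ∏ i ∈ Finset.range j, ((q : ℚ) ^ (i + 1) - 1) ≠ 0 :=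
    Finset.prod_ne_zero_iff.2 fun i _ => hne i
  have hj := hne j
  unfold qBinomial
  rw [Finset.prod_range_succ' (fun i => (q : ℚ) ^ (m + 1 - i) - 1)]
  simp only [Nat.add_sub_add_right, Nat.sub_zero]
  rw [Finset.prod_range_succ (fun i => (q : ℚ) ^ (m - i) - 1), Finset.prod_range_succ]
  have hs : (q : ℚ) ^ (m + 1) = (q : ℚ) ^ (j + 1) * (q : ℚ) ^ (m - j) := by
    rw [← pow_add]; congr 1; omega
  rw [hs]
  field_simp
  ring

lemma qBinomial_zero (q m : ℕ) : qBinomial q m 0 = 1 := by simp [qBinomial]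

lemma qBinomial_succ_self (q m : ℕ) : qBinomial q m (m + 1) = 0 := by
  simp [qBinomial, Finset.prod_range_succ]

variable {V : Type*} [AddCommGroup V] [Module F V] [Finite V]

/-- Complements of a line correspond to projections onto it. These form a coset of the kernel of
restriction to the line, a space of dimension `finrank F V - 1`. -/
lemma card_isCompl_span {v : V} (hv : v ≠ 0) :
    Nat.card {B : Submodule F V // IsCompl (F ∙ v) B} = Fintype.card F ^ (finrank F V - 1) := by
  set p : Submodule F V := F ∙ v
  have hp : finrank F p = 1 := finrank_span_singleton hv
  rw [Nat.card_congr (Submodule.isComplEquivProj p)]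
  let T : (V →ₗ[F] p) →ₗ[F] (p →ₗ[F] p) := LinearMap.lcomp F p p.subtype
  have hT : Function.Surjective T := fun f => by
    obtain ⟨g, hg⟩ := f.exists_extend
    exact ⟨g, hg⟩
  obtain ⟨f₀, hf₀⟩ := hT LinearMap.id
  have e : {f : V →ₗ[F] p // ∀ x : p, f x = x} ≃ LinearMap.ker T :=
    { toFun := fun f => ⟨f.1 - f₀, by
        rw [LinearMap.mem_ker, map_sub, hf₀, sub_eq_zero]
        ext x
        exact congrArg Subtype.val (f.2 x)⟩
      invFun := fun g => ⟨g.1 + f₀, fun x => by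
        have h1 : T g.1 x = 0 := by rw [LinearMap.mem_ker.1 g.2]; rfl
        have h2 : T f₀ x = x := by rw [hf₀]; rfl
        have h1' : g.1 x = 0 := h1
        have h2' : f₀ x = x := h2
        rw [LinearMap.add_apply, h1', h2', zero_add]⟩
      left_inv := fun f => by simp
      right_inv := fun g => by simp }
  rw [Nat.card_congr e, Module.natCard_eq_pow_finrank (K := F), Nat.card_eq_fintype_card]
  congr 1
  have h := LinearMap.finrank_range_add_finrank_ker T
  rw [LinearMap.range_eq_top.2 hT, finrank_top, finrank_linearMap, finrank_linearMap, hp] at h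
  omega

open Classical in
lemma sum_submodule_le (B₀ : Submodule F V) (h : Submodule F V → ℚ) :
    (∑ B with B ≤ B₀, h B) = ∑ B : Submodule F B₀, h (B.map B₀.subtype) := by
  symm
  refine Finset.sum_bij (fun B _ => B.map B₀.subtype) ?_ ?_ ?_ ?_
  · intro B _; simpa using Submodule.map_subtype_le B₀ B
  · intro B _ B' _ hB
    exact Submodule.map_injective_of_injective B₀.injective_subtype hB
  · intro B hB
    refine ⟨B.comap B₀.subtype, Finset.mem_univ _, ?_⟩
    rw [Submodule.map_comap_subtype]
    simpa using hB
  · intro B _; rfl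

lemma card_sup_span_eq {v : V} (hv : v ≠ 0) {Z : Submodule F V} (hZ : v ∈ Z) :
    Nat.card {B : Submodule F V // v ∉ B ∧ B ⊔ F ∙ v = Z} =
      Fintype.card F ^ (finrank F Z - 1) := by
  have hv' : (⟨v, hZ⟩ : Z) ≠ 0 := fun h => hv (congrArg Subtype.val h)
  rw [← card_isCompl_span hv']
  have hspan : (F ∙ (⟨v, hZ⟩ : Z)).map Z.subtype = F ∙ v := by
    simp [Submodule.map_span]
  have key : ∀ B : Submodule F Z, IsCompl (F ∙ (⟨v, hZ⟩ : Z)) B ↔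
      v ∉ B.map Z.subtype ∧ B.map Z.subtype ⊔ F ∙ v = Z := by
    intro B
    rw [isCompl_iff, disjoint_comm, Submodule.disjoint_span_singleton' hv', codisjoint_iff]
    refine and_congr ?_ ?_
    · simp [hZ]
    · rw [← hspan, ← Submodule.map_sup, sup_comm]
      constructor
      · intro h; rw [h, Submodule.map_subtype_top]
      · intro h
        apply Submodule.map_injective_of_injective Z.injective_subtype
        rw [h, Submodule.map_subtype_top]
  symm
  refine Nat.card_congr (Equiv.ofBijective
    (fun B => ⟨B.1.map Z.subtype, (key B.1).1 B.2⟩) ⟨?_, ?_⟩)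
  · intro B B' h
    exact Subtype.ext (Submodule.map_injective_of_injective Z.injective_subtype
      (congrArg Subtype.val h))
  · rintro ⟨B, hB⟩
    have hmap : (B.comap Z.subtype).map Z.subtype = B := by
      rw [Submodule.map_comap_subtype]
      exact inf_eq_right.2 (hB.2 ▸ le_sup_left)
    exact ⟨⟨B.comap Z.subtype, (key _).2 (by rw [hmap]; exact hB)⟩, Subtype.ext hmap⟩

lemma finrank_sup_span {v : V} {B : Submodule F V} (h : v ∉ B) :
    finrank F (B ⊔ F ∙ v : Submodule F V) = finrank F B + 1 := by
  have hv : v ≠ 0 := fun h0 => h (h0 ▸ B.zero_mem)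
  have h1 := Submodule.finrank_sup_add_finrank_inf_eq B (F ∙ v)
  rw [((Submodule.disjoint_span_singleton' hv).2 h).eq_bot, finrank_bot,
    finrank_span_singleton hv] at h1
  omega

open Classical in
/-- A sum over all subspaces, grouped by the join with a fixed line. -/
lemma sum_submodule_eq_sum_mem {v : V} (hv : v ≠ 0) (f : ℕ → ℚ) (h : Submodule F V → ℚ)
    (hh : ∀ B, h (B ⊔ F ∙ v) = h B) :
    ∑ B : Submodule F V, f (finrank F B) * h B =
      ∑ Z : Submodule F V with v ∈ Z, (f (finrank F Z) +
        (Fintype.card F : ℚ) ^ (finrank F Z - 1) * f (finrank F Z - 1)) * h Z := by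
  rw [← Finset.sum_filter_add_sum_filter_not Finset.univ (fun B : Submodule F V => v ∈ B)]
  simp only [add_mul, Finset.sum_add_distrib]
  congr 1
  -- Each `Z` containing `v` is the join of the line with exactly `q^(dim Z - 1)` subspaces avoiding
  -- `v`, all of dimension `dim Z - 1`.
  rw [← Finset.sum_fiberwise_of_maps_to (t := Finset.univ.filter fun Z : Submodule F V => v ∈ Z)
    (g := fun B : Submodule F V => B ⊔ F ∙ v)]
  · refine Finset.sum_congr rfl fun Z hZ => ?_
    have hvZ : v ∈ Z := by simpa using hZ
    have hc := card_sup_span_eq hv hvZ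
    rw [Nat.card_eq_fintype_card, Fintype.card_subtype] at hc
    rw [Finset.filter_filter, Finset.sum_congr rfl
      (g := fun _ => f (finrank F Z - 1) * h Z), Finset.sum_const, hc]
    · rw [nsmul_eq_mul]; push_cast; ring
    · intro B hB
      obtain ⟨h1, h2⟩ := (Finset.mem_filter.1 hB).2
      have h3 := finrank_sup_span h1
      rw [h2] at h3
      rw [← hh B, h2, h3, Nat.add_sub_cancel]
  · intro B _
    simpa using Submodule.mem_sup_right (Submodule.mem_span_singleton_self v)

/-- After grouping by the join with the line, `Z` has coefficient `μ(d + 1) + q^d μ(d) = 0`, where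
`dim Z = d + 1`. This cancellation is behind every Möbius sum below. -/
lemma sum_mobiusValue_mul_eq_zero {v : V} (hv : v ≠ 0) (h : Submodule F V → ℚ)
    (hh : ∀ B, h (B ⊔ F ∙ v) = h B) :
    ∑ B : Submodule F V, mobiusValue (Fintype.card F) (finrank F B) * h B = 0 := by
  classical
  rw [sum_submodule_eq_sum_mem hv _ h hh]
  refine Finset.sum_eq_zero fun Z hZ => ?_
  have hvZ : v ∈ Z := by simpa using hZ
  have hpos : 0 < finrank F Z := by
    rw [Module.finrank_pos_iff]
    exact ⟨⟨v, hvZ⟩, 0, fun h => hv (congrArg Subtype.val h)⟩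
  obtain ⟨d, hd⟩ := Nat.exists_eq_succ_of_ne_zero hpos.ne'
  rw [hd, Nat.succ_eq_add_one, mobiusValue_succ, Nat.add_sub_cancel]
  ring

instance quotientFinite (p : Submodule F V) : Finite (V ⧸ p) := Quotient.finite _

open Classical in
lemma sum_mem_eq_sum_quotient (v : V) (f : ℕ → ℚ) (hv : v ≠ 0) :
    ∑ Z : Submodule F V with v ∈ Z, f (finrank F Z) =
      ∑ B : Submodule F (V ⧸ (F ∙ v)), f (finrank F B + 1) := by
  symm
  refine Finset.sum_bij (fun B _ => B.comap (F ∙ v).mkQ) ?_ ?_ ?_ ?_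
  · intro B _
    have h0 : (F ∙ v).mkQ v = 0 := by simp
    simp only [Finset.mem_filter, Finset.mem_univ, true_and, Submodule.mem_comap, h0,
      Submodule.zero_mem]
  · intro B _ B' _ hB
    exact Submodule.comap_injective_of_surjective (F ∙ v).mkQ_surjective hB
  · intro Z hZ
    have hvZ : v ∈ Z := by simpa using hZ
    refine ⟨Z.map (F ∙ v).mkQ, Finset.mem_univ _, ?_⟩
    rw [Submodule.comap_map_mkQ, sup_eq_right, Submodule.span_singleton_le_iff_mem]
    exact hvZ
  · intro B _
    congr 1
    set Z := B.comap (F ∙ v).mkQ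
    have hle : F ∙ v ≤ Z := by
      rw [Submodule.span_singleton_le_iff_mem]
      have h0 : (F ∙ v).mkQ v = 0 := by simp
      simp only [Z, Submodule.mem_comap, h0, Submodule.zero_mem]
    have h1 := LinearMap.finrank_range_add_finrank_ker ((F ∙ v).mkQ.domRestrict Z)
    rw [LinearMap.range_domRestrict, Submodule.map_comap_eq_of_surjective
      (Submodule.mkQ_surjective _), LinearMap.ker_domRestrict, Submodule.ker_mkQ,
      (Submodule.comapSubtypeEquivOfLe hle).finrank_eq, finrank_span_singleton hv] at h1
    exact h1

/-- Induction through the quotient by a line; the recursion is the `q`-Pascal rule. It identifies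
`qBinomial` with the number of subspaces. -/
lemma sum_finrank_eq (f : ℕ → ℚ) {n : ℕ} (hn : finrank F V = n) :
    ∑ B : Submodule F V, f (finrank F B) =
      ∑ l ∈ Finset.range (n + 1), qBinomial (Fintype.card F) n l * f l := by
  classical
  induction n generalizing V f with
  | zero =>
    have : Subsingleton V := Module.finrank_zero_iff.1 hn
    rw [Fintype.sum_subsingleton _ (⊥ : Submodule F V)]
    simp [qBinomial_zero]
  | succ n ih =>
    have : Nontrivial V := Module.nontrivial_of_finrank_pos (R := F) (by omega)
    obtain ⟨v, hv⟩ := exists_ne (0 : V)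
    have hquot : finrank F (V ⧸ (F ∙ v)) = n := by
      have := Submodule.finrank_quotient_add_finrank (F ∙ v)
      rw [finrank_span_singleton hv] at this
      omega
    have h1 := sum_submodule_eq_sum_mem (F := F) hv f (fun _ => 1) fun _ => rfl
    simp only [mul_one] at h1
    rw [h1, sum_mem_eq_sum_quotient v
      (fun z => f z + (Fintype.card F : ℚ) ^ (z - 1) * f (z - 1)) hv]
    simp only [Nat.add_sub_cancel]
    rw [ih (fun z => f (z + 1) + (Fintype.card F : ℚ) ^ z * f z) hquot,
      Finset.sum_range_succ' _ (n + 1)]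
    have h2 : ∀ l ∈ Finset.range (n + 1),
        qBinomial (Fintype.card F) (n + 1) (l + 1) * f (l + 1) =
          qBinomial (Fintype.card F) n l * f (l + 1) +
          qBinomial (Fintype.card F) n (l + 1) *
            ((Fintype.card F : ℚ) ^ (l + 1) * f (l + 1)) := by
      intro l hl
      rw [qBinomial_succ_succ Fintype.one_lt_card (by simpa [Nat.lt_succ_iff] using hl)]
      ring
    rw [Finset.sum_congr rfl h2]
    simp only [mul_add, Finset.sum_add_distrib]
    have h3 := Finset.sum_range_succ' (fun l => qBinomial (Fintype.card F) n l *
      ((Fintype.card F : ℚ) ^ l * f l)) (n + 1)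
    rw [Finset.sum_range_succ, qBinomial_succ_self] at h3
    simp only [qBinomial_zero, pow_zero, zero_mul, add_zero] at h3 ⊢
    rw [h3]
    ring

/-- The alternating sum `∑ l, (-1)^l q^(l choose 2) [j, l]_q W_l`. -/
def altSum (q : ℕ) (W : ℕ → ℚ) (j : ℕ) : ℚ :=
  ∑ l ∈ Finset.range (j + 1), (-1) ^ l * (q : ℚ) ^ (l.choose 2) * qBinomial q j l * W l

lemma sum_mobiusValue_finrank (W : ℕ → ℚ) :
    ∑ B : Submodule F V, mobiusValue (Fintype.card F) (finrank F B) * W (finrank F B) =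
      altSum (Fintype.card F) W (finrank F V) := by
  rw [sum_finrank_eq (fun d => mobiusValue (Fintype.card F) d * W d) rfl, altSum]
  refine Finset.sum_congr rfl fun l _ => ?_
  rw [mobiusValue]
  ring

lemma finrank_map_subtype (B₀ : Submodule F V) (B : Submodule F B₀) :
    finrank F (B.map B₀.subtype) = finrank F B :=
  (Submodule.equivMapOfInjective _ B₀.injective_subtype B).finrank_eq.symm

variable {V' : Type*} [AddCommGroup V'] [Module F V']

open Classical in
-- A nonzero vector of `B₀` killed by `x` can be joined to `B` without changing its image, so the
-- sum cancels. Otherwise `x` preserves the dimensions of all subspaces of `B₀`.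
lemma sum_le_mobiusValue_finrank_map (W : ℕ → ℚ) (x : V →ₗ[F] V') (B₀ : Submodule F V) :
    (∑ B with B ≤ B₀, mobiusValue (Fintype.card F) (finrank F B) * W (finrank F (B.map x))) =
      if Disjoint B₀ (LinearMap.ker x) then altSum (Fintype.card F) W (finrank F B₀) else 0 := by
  rw [sum_submodule_le B₀
    (fun B => mobiusValue (Fintype.card F) (finrank F B) * W (finrank F (B.map x)))]
  simp only [finrank_map_subtype]
  split_ifs with hd
  · rw [← sum_mobiusValue_finrank]
    refine Finset.sum_congr rfl fun B _ => ?_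
    have hinj : Function.Injective (x ∘ₗ B₀.subtype) := by
      rw [← LinearMap.ker_eq_bot, LinearMap.ker_comp, ← Submodule.disjoint_iff_comap_eq_bot]
      exact hd
    rw [← Submodule.map_comp, ← (Submodule.equivMapOfInjective _ hinj B).finrank_eq]
  · rw [Submodule.disjoint_def] at hd
    push Not at hd
    obtain ⟨v, hv, hxv, hv0⟩ := hd
    refine sum_mobiusValue_mul_eq_zero (v := (⟨v, hv⟩ : B₀))
      (fun h => hv0 (congrArg Subtype.val h)) _ fun B => ?_
    have hbot : ((F ∙ (⟨v, hv⟩ : B₀)).map B₀.subtype).map x = ⊥ := by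
      simp [Submodule.map_span, LinearMap.mem_ker.1 hxv]
    rw [Submodule.map_sup, Submodule.map_sup, hbot, sup_bot_eq]

open Classical in
lemma sum_le_mobiusValue_le (B₀ K : Submodule F V) :
    (∑ B with B ≤ B₀, mobiusValue (Fintype.card F) (finrank F B) *
      (if B ≤ K then 1 else 0)) = if Disjoint B₀ K then 1 else 0 := by
  rw [sum_submodule_le B₀
    (fun B => mobiusValue (Fintype.card F) (finrank F B) * (if B ≤ K then 1 else 0))]
  simp only [finrank_map_subtype]
  split_ifs with hd
  · rw [Finset.sum_eq_single ⊥]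
    · simp [mobiusValue]
    · intro B _ hB
      rw [if_neg, mul_zero]
      intro hBK
      apply hB
      apply Submodule.map_injective_of_injective B₀.injective_subtype
      rw [Submodule.map_bot, eq_bot_iff]
      exact hd (Submodule.map_subtype_le B₀ B) hBK
    · simp
  · rw [Submodule.disjoint_def] at hd
    push Not at hd
    obtain ⟨v, hv, hxv, hv0⟩ := hd
    refine sum_mobiusValue_mul_eq_zero (v := (⟨v, hv⟩ : B₀))
      (fun h => hv0 (congrArg Subtype.val h)) _ fun B => ?_
    rw [Submodule.map_sup]
    simp [Submodule.map_span, hxv]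

end Subspaces

/-! ### Weights as functions of the rank -/

section Rank

variable {F : Type*} [Field F] [Fintype F] {k : ℕ}

lemma apply_units_mul {w : Matrix (Fin k) (Fin k) F → ℕ} (hsym : HasMaximalSymmetry w)
    (u : (Matrix (Fin k) (Fin k) F)ˣ) (r : Matrix (Fin k) (Fin k) F) :
    w (u * r) = w r := by
  have h : u ∈ leftSymmetry w := hsym.1 ▸ Subgroup.mem_top u
  exact h r

lemma apply_mul_units {w : Matrix (Fin k) (Fin k) F → ℕ} (hsym : HasMaximalSymmetry w)
    (u : (Matrix (Fin k) (Fin k) F)ˣ) (r : Matrix (Fin k) (Fin k) F) :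
    w (r * u) = w r := by
  have h : u ∈ rightSymmetry w := hsym.2 ▸ Subgroup.mem_top u
  exact h r

/-- Square matrices of the same rank are equivalent. -/
lemma exists_units_mul_mul_eq {n : Type*} [Fintype n] [DecidableEq n] {r s : Matrix n n F}
    (h : r.rank = s.rank) : ∃ u v : (Matrix n n F)ˣ, s = u * r * v := by
  obtain ⟨U, V, e, hU, hV, hr⟩ := r.exists_rank_normal_form
  have hex := s.exists_rank_normal_form
  rw [← h] at hex
  obtain ⟨U', V', e', hU', hV', hs⟩ := hex
  -- The two normal forms may split the index set differently; the permutation matrices of `σ`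
  -- reconcile them.
  let σ : n ≃ n := e'.trans e.symm
  have hone : (1 : Matrix n n F).submatrix σ id * (1 : Matrix n n F).submatrix id σ = 1 := by
    rw [← Matrix.submatrix_mul _ _ _ _ _ Function.bijective_id, mul_one,
      Matrix.submatrix_one_equiv]
  obtain ⟨P, hP⟩ := IsUnit.of_mul_eq_one _ hone
  obtain ⟨Q, hQ⟩ := IsUnit.of_mul_eq_one_right _ hone
  obtain ⟨U, rfl⟩ := hU
  obtain ⟨V, rfl⟩ := hV
  obtain ⟨U', rfl⟩ := hU'
  obtain ⟨V', rfl⟩ := hV'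
  have hPQ : ((U' : Matrix n n F) * s * V') = P * (U * r * V) * Q := by
    rw [hs, hr, hP, hQ, ← Matrix.submatrix_id_id ((Matrix.fromBlocks 1 0 0 0).submatrix e e),
      ← Matrix.submatrix_mul _ _ _ _ _ Function.bijective_id,
      ← Matrix.submatrix_mul _ _ _ _ _ Function.bijective_id, one_mul, mul_one,
      Matrix.submatrix_submatrix]
    congr 1 <;> ext i <;> simp [σ]
  refine ⟨U'⁻¹ * P * U, V * Q * V'⁻¹, ?_⟩
  calc s = (U'⁻¹ : (Matrix n n F)ˣ) * ((U' : Matrix n n F) * s * V') *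
        (V'⁻¹ : (Matrix n n F)ˣ) := by
        simp [mul_assoc]
    _ = _ := by rw [hPQ]; simp only [Units.val_mul, mul_assoc]

lemma rank_diagonal_lt {l : ℕ} (hl : l ≤ k) :
    (Matrix.diagonal fun i : Fin k => if (i : ℕ) < l then (1 : F) else 0).rank = l := by
  classical
  rw [Matrix.rank_diagonal]
  have h : ∀ i : Fin k, (if (i : ℕ) < l then (1 : F) else 0) ≠ 0 ↔ (i : ℕ) < l := by
    intro i; split_ifs <;> simp_all
  simp only [h]
  rw [Fintype.card_subtype, Fin.card_filter_val_lt, min_eq_right hl]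

/-- A weight with maximal symmetry depends only on the rank. -/
lemma apply_eq_rankValue {w : Matrix (Fin k) (Fin k) F → ℕ} (hsym : HasMaximalSymmetry w)
    (r : Matrix (Fin k) (Fin k) F) : w r = rankValue w r.rank := by
  have hr : r.rank ≤ k := by simpa using r.rank_le_card_width
  obtain ⟨u, v, h⟩ := exists_units_mul_mul_eq (rank_diagonal_lt (F := F) hr)
  rw [rankValue]
  conv_lhs => rw [h, apply_mul_units hsym, apply_units_mul hsym]

variable {m : ℕ}

lemma exists_range_mulVecLin_eq {B : Submodule F (Fin m → F)} (hB : finrank F B ≤ k) :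
    ∃ l : Matrix (Fin m) (Fin k) F, LinearMap.range l.mulVecLin = B := by
  obtain ⟨f, hf⟩ : ∃ f : (Fin k → F) →ₗ[F] B, Function.Surjective f := by
    let b := Module.finBasis F B
    refine ⟨(Pi.basisFun F (Fin k)).constr F
      fun i => if h : (i : ℕ) < finrank F B then b ⟨i, h⟩ else 0, ?_⟩
    rw [← LinearMap.range_eq_top, Module.Basis.constr_range, eq_top_iff, ← b.span_eq]
    refine Submodule.span_mono ?_
    rintro _ ⟨i, rfl⟩
    exact ⟨⟨i, i.2.trans_le hB⟩, by simp⟩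
  refine ⟨LinearMap.toMatrix' (B.subtype ∘ₗ f), ?_⟩
  rw [← Matrix.toLin'_apply', Matrix.toLin'_toMatrix', LinearMap.range_comp,
    LinearMap.range_eq_top.2 hf, Submodule.map_subtype_top]

lemma rank_mul_eq_finrank_map (x : Matrix (Fin k) (Fin m) F) (l : Matrix (Fin m) (Fin k) F) :
    (x * l).rank = finrank F ((LinearMap.range l.mulVecLin).map x.mulVecLin) := by
  rw [Matrix.rank, Matrix.mulVecLin_mul, LinearMap.range_comp]

end Rank

/-! ### Kernel indicators as combinations of weights -/

section Span

variable {F : Type*} [Field F] [Fintype F] {k : ℕ}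

lemma altSum_ne_zero {w : Matrix (Fin k) (Fin k) F → ℕ} (hnd : IsNondegenerate w) {j : ℕ}
    (h1 : 1 ≤ j) (hk : j ≤ k) : altSum (Fintype.card F) (fun l => (rankValue w l : ℚ)) j ≠ 0 :=
  fun h => hnd j (Finset.mem_Icc.2 ⟨h1, hk⟩) (by rw [diagCoeff]; exact mul_eq_zero_of_right _ h)

/-- The rational span of the functions `x ↦ w (x * l)` on `k × m` matrices. -/
noncomputable def weightSpan (w : Matrix (Fin k) (Fin k) F → ℕ) (m : ℕ) :
    Submodule ℚ (Matrix (Fin k) (Fin m) F → ℚ) :=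
  Submodule.span ℚ (Set.range fun (l : Matrix (Fin m) (Fin k) F) x => (w (x * l) : ℚ))

variable {w : Matrix (Fin k) (Fin k) F → ℕ} (hsym : HasMaximalSymmetry w) {m : ℕ}
include hsym

lemma apply_mul_eq_rankValue (x : Matrix (Fin k) (Fin m) F) (l : Matrix (Fin m) (Fin k) F) :
    w (x * l) = rankValue w (finrank F ((LinearMap.range l.mulVecLin).map x.mulVecLin)) := by
  rw [apply_eq_rankValue hsym, rank_mul_eq_finrank_map]

lemma rankValue_finrank_map_mem_weightSpan {B : Submodule F (Fin m → F)} (hB : finrank F B ≤ k) :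
    (fun x : Matrix (Fin k) (Fin m) F => (rankValue w (finrank F (B.map x.mulVecLin)) : ℚ)) ∈
      weightSpan w m := by
  obtain ⟨l, rfl⟩ := exists_range_mulVecLin_eq hB
  refine Submodule.subset_span ⟨l, ?_⟩
  funext x
  exact congrArg Nat.cast (apply_mul_eq_rankValue hsym x l)

open Classical in
-- For `finrank F B ≤ k`, this is the Möbius sum of the weights over subspaces of `B`, divided by an
-- alternating sum that nondegeneracy makes nonzero. In larger dimension no `x` is injective on `B`,
-- and the function is zero.
lemma disjoint_ker_mem_weightSpan (hnd : IsNondegenerate w) {B : Submodule F (Fin m → F)}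
    (hB : B ≠ ⊥) :
    (fun x : Matrix (Fin k) (Fin m) F =>
      if Disjoint B (LinearMap.ker x.mulVecLin) then (1 : ℚ) else 0) ∈ weightSpan w m := by
  rcases le_or_gt (finrank F B) k with hk | hk
  · have h1 : 1 ≤ finrank F B := Nat.one_le_iff_ne_zero.2 fun h => hB (Submodule.finrank_eq_zero.1 h)
    have ha := altSum_ne_zero hnd h1 hk
    have hmem : (fun x : Matrix (Fin k) (Fin m) F => ∑ B' with B' ≤ B,
        mobiusValue (Fintype.card F) (finrank F B') *
          (rankValue w (finrank F (B'.map x.mulVecLin)) : ℚ)) ∈ weightSpan w m := by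
      have : (fun x : Matrix (Fin k) (Fin m) F => ∑ B' with B' ≤ B,
          mobiusValue (Fintype.card F) (finrank F B') *
            (rankValue w (finrank F (B'.map x.mulVecLin)) : ℚ)) =
          ∑ B' with B' ≤ B, mobiusValue (Fintype.card F) (finrank F B') •
            fun x : Matrix (Fin k) (Fin m) F =>
              (rankValue w (finrank F (B'.map x.mulVecLin)) : ℚ) := by
        funext x; simp [Finset.sum_apply]
      rw [this]
      refine Submodule.sum_mem _ fun B' hB' => Submodule.smul_mem _ _
        (rankValue_finrank_map_mem_weightSpan hsym ?_)
      exact (Submodule.finrank_mono (Finset.mem_filter.1 hB').2).trans hk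
    convert Submodule.smul_mem _
      (altSum (Fintype.card F) (fun l => (rankValue w l : ℚ)) (finrank F B))⁻¹ hmem using 1
    funext x
    rw [Pi.smul_apply, sum_le_mobiusValue_finrank_map (fun l => (rankValue w l : ℚ))]
    split_ifs
    · rw [smul_eq_mul, inv_mul_cancel₀ ha]
    · rw [smul_zero]
  · convert Submodule.zero_mem (weightSpan w m) using 1
    funext x
    rw [if_neg, Pi.zero_apply]
    intro hd
    have hinj : Function.Injective (x.mulVecLin ∘ₗ B.subtype) := by
      rw [← LinearMap.ker_eq_bot, LinearMap.ker_comp, ← Submodule.disjoint_iff_comap_eq_bot]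
      exact hd
    have := LinearMap.finrank_le_finrank_of_injective hinj
    simp at this
    omega

open Classical in
-- The Möbius sum over `B' ≤ B` of these functions is the indicator of disjointness; solve for the
-- term `B' = B`. The subtracted `1` makes the functions vanish at `x = 0`, as weights do when `w 0
-- = 0`.
lemma le_ker_sub_one_mem_weightSpan (hnd : IsNondegenerate w) (B : Submodule F (Fin m → F)) :
    (fun x : Matrix (Fin k) (Fin m) F =>
      (if B ≤ LinearMap.ker x.mulVecLin then (1 : ℚ) else 0) - 1) ∈ weightSpan w m := by
  induction B using WellFoundedLT.induction with
  | ind B ih =>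
    rcases eq_or_ne B ⊥ with rfl | hB
    · convert Submodule.zero_mem (weightSpan w m) using 1
      funext x; simp
    have hne : mobiusValue (Fintype.card F) (finrank F B) ≠ 0 :=
      mobiusValue_ne_zero Fintype.card_ne_zero _
    have hsum : (∑ B' with B' < B, mobiusValue (Fintype.card F) (finrank F B') •
        fun x : Matrix (Fin k) (Fin m) F =>
          (if B' ≤ LinearMap.ker x.mulVecLin then (1 : ℚ) else 0) - 1) ∈ weightSpan w m :=
      Submodule.sum_mem _ fun B' hB' =>
        Submodule.smul_mem _ _ (ih B' (Finset.mem_filter.1 hB').2)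
    convert Submodule.smul_mem _ (mobiusValue (Fintype.card F) (finrank F B))⁻¹
      (Submodule.sub_mem _ (disjoint_ker_mem_weightSpan hsym hnd hB) hsum) using 1
    funext x
    have h1 := sum_le_mobiusValue_le B (LinearMap.ker x.mulVecLin)
    have h2 := sum_le_mobiusValue_le B ⊤
    rw [if_neg (by simpa using hB)] at h2
    simp only [le_top, if_true] at h2
    have hfilter : (Finset.univ.filter fun B' : Submodule F (Fin m → F) => B' ≤ B) =
        insert B (Finset.univ.filter fun B' => B' < B) := by
      ext B'; simp [le_iff_eq_or_lt]
    have h3 : (∑ B' with B' ≤ B, mobiusValue (Fintype.card F) (finrank F B') *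
        ((if B' ≤ LinearMap.ker x.mulVecLin then (1 : ℚ) else 0) - 1)) =
        if Disjoint B (LinearMap.ker x.mulVecLin) then 1 else 0 := by
      simp only [mul_sub, Finset.sum_sub_distrib]
      rw [h1, h2, sub_zero]
    rw [hfilter, Finset.sum_insert (by simp)] at h3
    simp only [Pi.smul_apply, Pi.sub_apply, Finset.sum_apply, smul_eq_mul]
    rw [← h3, add_sub_cancel_right, inv_mul_cancel_left₀ hne]

open Classical in
-- From the indicator of `K ≤ ker x`, remove those of the strictly larger kernels, by downward
-- induction. Subtracting the case `⊤` removes the zero matrix and cancels the constant `1`.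
lemma ker_eq_mem_weightSpan (hnd : IsNondegenerate w) (K : Submodule F (Fin m → F))
    (hK : K ≠ ⊤) :
    (fun x : Matrix (Fin k) (Fin m) F =>
      if LinearMap.ker x.mulVecLin = K then (1 : ℚ) else 0) ∈ weightSpan w m := by
  induction K using WellFoundedGT.induction with
  | ind K ih =>
    have hsum : (∑ K' with K < K' ∧ K' ≠ ⊤, fun x : Matrix (Fin k) (Fin m) F =>
          if LinearMap.ker x.mulVecLin = K' then (1 : ℚ) else 0) ∈ weightSpan w m :=
      Submodule.sum_mem _ fun K' hK' =>
        ih K' (Finset.mem_filter.1 hK').2.1 (Finset.mem_filter.1 hK').2.2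
    convert Submodule.sub_mem _ (Submodule.sub_mem _ (le_ker_sub_one_mem_weightSpan hsym hnd K)
      (le_ker_sub_one_mem_weightSpan hsym hnd ⊤)) hsum using 1
    funext x
    simp only [Pi.sub_apply, Finset.sum_apply, sub_sub_sub_cancel_right, Finset.sum_ite_eq,
      Finset.mem_filter, Finset.mem_univ, true_and, top_le_iff]
    by_cases h1 : LinearMap.ker x.mulVecLin = ⊤
    · simp [h1, hK.symm]
    · by_cases h2 : LinearMap.ker x.mulVecLin = K
      · simp [h2, hK]
      · simp [h1, h2, lt_iff_le_and_ne, Ne.symm h2]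

open Classical in
/-- For a nondegenerate weight, the indicator function of the matrices with a given proper kernel
is a rational combination of the functions `x ↦ w (x * l)`. -/
lemma exists_sum_mul_eq_ite_ker (hnd : IsNondegenerate w) {K : Submodule F (Fin m → F)}
    (hK : K ≠ ⊤) : ∃ ε : Matrix (Fin m) (Fin k) F → ℚ, ∀ x : Matrix (Fin k) (Fin m) F,
      ∑ l, ε l * (w (x * l) : ℚ) = if LinearMap.ker x.mulVecLin = K then 1 else 0 := by
  obtain ⟨ε, hε⟩ := (Submodule.mem_span_range_iff_exists_fun ℚ).1
    (ker_eq_mem_weightSpan hsym hnd K hK)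
  refine ⟨ε, fun x => ?_⟩
  simpa [Finset.sum_apply] using congrFun hε x

end Span

/-! ### Codes from column multiplicities, and their duals -/

section Codes

variable {F : Type*} [Field F] [Fintype F] {k m : ℕ}

/-- The left linear code of all `(x * l 0, …, x * l (n - 1))`, for `k × m` matrices `x`. -/
def matrixCode {n : ℕ} (l : Fin n → Matrix (Fin m) (Fin k) F) :
    Submodule (Matrix (Fin k) (Fin k) F) (Fin n → Matrix (Fin k) (Fin k) F) where
  carrier := Set.range fun (x : Matrix (Fin k) (Fin m) F) i => x * l i
  add_mem' := by
    rintro _ _ ⟨x, rfl⟩ ⟨y, rfl⟩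
    exact ⟨x + y, funext fun i => Matrix.add_mul x y (l i)⟩
  zero_mem' := ⟨0, funext fun i => Matrix.zero_mul (l i)⟩
  smul_mem' := by
    rintro r _ ⟨x, rfl⟩
    exact ⟨r * x, funext fun i => Matrix.mul_assoc r x (l i)⟩

lemma eq_of_forall_mul_eq (hk : 0 < k) {x y : Matrix (Fin k) (Fin m) F}
    (h : ∀ l : Matrix (Fin m) (Fin k) F, x * l = y * l) : x = y := by
  ext i j
  have := congrFun (congrFun (h (Matrix.single j ⟨0, hk⟩ 1)) i) ⟨0, hk⟩
  simpa using this

lemma eq_zero_of_forall_mul_eq_zero (hk : 0 < k) {z : Matrix (Fin m) (Fin k) F}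
    (h : ∀ x : Matrix (Fin k) (Fin m) F, x * z = 0) : z = 0 := by
  ext i j
  have := congrFun (congrFun (h (Matrix.single ⟨0, hk⟩ i 1)) ⟨0, hk⟩) j
  simpa using this

variable (w : Matrix (Fin k) (Fin k) F → ℕ)

/-- When every matrix occurs as a column, `x` is determined by its codeword, so the sum may run over
`x`. -/
lemma weightEnumerator_matrixCode (hk : 0 < k) {n : ℕ} (l : Fin n → Matrix (Fin m) (Fin k) F)
    (hl : Function.Surjective l) :
    weightEnumerator w (matrixCode l : Set (Fin n → Matrix (Fin k) (Fin k) F)) =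
      ∑ x : Matrix (Fin k) (Fin m) F,
        MvPolynomial.X 0 ^ (n * maxWeight w - ∑ i, w (x * l i)) *
          MvPolynomial.X 1 ^ (∑ i, w (x * l i)) := by
  classical
  rw [weightEnumerator]
  symm
  refine Finset.sum_bij (fun x _ i => x * l i) ?_ ?_ ?_ ?_
  · intro x _
    exact Finset.mem_filter.2 ⟨Finset.mem_univ _, ⟨x, rfl⟩⟩
  · intro x _ y _ hxy
    refine eq_of_forall_mul_eq hk fun z => ?_
    obtain ⟨i, rfl⟩ := hl z
    exact congrFun hxy i
  · intro v hv
    obtain ⟨x, hx⟩ := (Finset.mem_filter.1 hv).2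
    exact ⟨x, Finset.mem_univ _, hx⟩
  · intro x _; rfl

open Classical in
/-- The number of matrices of weight `d` annihilated by `l` from the left. -/
noncomputable def annihilatedCount (d : ℕ) (l : Matrix (Fin m) (Fin k) F) : ℕ :=
  Finset.card {r : Matrix (Fin k) (Fin k) F | w r = d ∧ l * r = 0}

variable {w}

lemma minWeight_le {r : Matrix (Fin k) (Fin k) F} (hr : r ≠ 0) : minWeight w ≤ w r :=
  Nat.sInf_le ⟨r, hr, rfl⟩

/-- Two nonzero entries would already weigh at least `2 * minWeight w`, so a word of weight `d` has
exactly one. -/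
lemma weightCount_dualCode_matrixCode (hw : IsPositiveWeight w) (hk : 0 < k) {d : ℕ}
    (hd : 0 < d) (hd2 : d < 2 * minWeight w) {n : ℕ} (l : Fin n → Matrix (Fin m) (Fin k) F) :
    weightCount w (dualCode (matrixCode l) : Set (Fin n → Matrix (Fin k) (Fin k) F)) d =
      ∑ i, annihilatedCount w d (l i) := by
  classical
  simp only [annihilatedCount]
  rw [← Finset.card_sigma, weightCount, Set.ncard_eq_toFinset_card']
  symm
  have hmem : ∀ (i : Fin n) (r : Matrix (Fin k) (Fin k) F),
      Pi.single i r ∈ dualCode (matrixCode l) ↔ l i * r = 0 := by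
    intro i r
    have hdot : ∀ x : Matrix (Fin k) (Fin m) F,
        (fun j => x * l j) ⬝ᵥ Pi.single i r = x * (l i * r) := fun x => by
      rw [dotProduct_single, Matrix.mul_assoc]
    constructor
    · intro h
      refine eq_zero_of_forall_mul_eq_zero hk fun x => ?_
      rw [← hdot]
      exact h _ ⟨x, rfl⟩
    · rintro h _ ⟨x, rfl⟩
      rw [hdot, h, Matrix.mul_zero]
  have hwt : ∀ (i : Fin n) (r : Matrix (Fin k) (Fin k) F), wt w (Pi.single i r) = w r := by
    intro i r
    rw [wt, Finset.sum_eq_single i]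
    · simp
    · intro j _ hj; rw [Pi.single_eq_of_ne hj, hw.1]
    · simp
  refine Finset.card_bij (fun p _ => Pi.single p.1 p.2) ?_ ?_ ?_
  · rintro ⟨i, r⟩ h
    simp only [Finset.mem_sigma, Finset.mem_univ, true_and, Finset.mem_filter] at h
    simp only [Set.mem_toFinset, Set.mem_ofPred_eq, SetLike.mem_coe]
    exact ⟨(hmem i r).2 h.2, (hwt i r).trans h.1⟩
  · rintro ⟨i, r⟩ h ⟨j, s⟩ h' heq
    simp only [Finset.mem_sigma, Finset.mem_univ, true_and, Finset.mem_filter] at h h' heq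
    have hr : r ≠ 0 := by
      rintro rfl
      rw [hw.1] at h
      omega
    have hij : i = j := by
      by_contra hij
      have := congrFun heq i
      rw [Pi.single_eq_same, Pi.single_eq_of_ne hij] at this
      exact hr this
    subst hij
    rw [Pi.single_injective i heq]
  · intro y hy
    simp only [Set.mem_toFinset, Set.mem_ofPred_eq, SetLike.mem_coe] at hy
    obtain ⟨i, hi⟩ : ∃ i, y i ≠ 0 := by
      by_contra h
      push Not at h
      have : wt w y = 0 := Finset.sum_eq_zero fun i _ => by rw [h, hw.1]
      omega
    have hy' : y = Pi.single i (y i) := by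
      funext j
      by_cases hj : j = i
      · subst hj; simp
      · rw [Pi.single_eq_of_ne hj]
        by_contra hne
        have h1 : w (y i) + w (y j) ≤ wt w y := by
          rw [← Finset.sum_pair (f := fun j => w (y j)) (Ne.symm hj)]
          exact Finset.sum_le_sum_of_subset (Finset.subset_univ _)
        have h2 := minWeight_le (w := w) hi
        have h3 := minWeight_le (w := w) hne
        omega
    refine ⟨⟨i, y i⟩, ?_, hy'.symm⟩
    simp only [Finset.mem_sigma, Finset.mem_univ, true_and, Finset.mem_filter]
    constructor
    · rw [← hwt i, ← hy', hy.2]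
    · rw [← hmem, ← hy']; exact hy.1

lemma exists_fin_family {H : Type*} [Fintype H] {a : H → ℕ} (ha : ∀ h, 1 ≤ a h) {n : ℕ}
    (hn : ∑ h, a h = n) : ∃ l : Fin n → H, Function.Surjective l ∧
      ∀ φ : H → ℕ, ∑ i, φ (l i) = ∑ h, a h * φ h := by
  let e : (Σ h, Fin (a h)) ≃ Fin n := Fintype.equivFinOfCardEq (by simp [hn])
  refine ⟨fun i => (e.symm i).1, fun h => ⟨e ⟨h, ⟨0, ha h⟩⟩, by simp⟩, fun φ => ?_⟩
  rw [Equiv.sum_comp e.symm (fun p => φ p.1), Fintype.sum_sigma]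
  simp

/-- There are two codes of the same length with equal weight enumerators, whose dual codes have
different numbers of vectors of weight `d`. -/
def HasSeparatingPair (w : Matrix (Fin k) (Fin k) F → ℕ) (d : ℕ) : Prop :=
  ∃ (n : ℕ) (C D : Submodule (Matrix (Fin k) (Fin k) F) (Fin n → Matrix (Fin k) (Fin k) F)),
    1 ≤ n ∧
    weightEnumerator w (C : Set (Fin n → Matrix (Fin k) (Fin k) F)) =
      weightEnumerator w (D : Set (Fin n → Matrix (Fin k) (Fin k) F)) ∧
    weightCount w (dualCode C : Set (Fin n → Matrix (Fin k) (Fin k) F)) d ≠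
      weightCount w (dualCode D : Set (Fin n → Matrix (Fin k) (Fin k) F)) d

/-- The hypothesis `hP` says that the two multisets of weights agree, in the form of equal sums of
an arbitrary function. -/
lemma sum_annihilatedCount_eq_of_not_hasSeparatingPair (hw : IsPositiveWeight w) (hk : 0 < k)
    {d : ℕ} (hd : 0 < d) (hd2 : d < 2 * minWeight w) (hno : ¬ HasSeparatingPair w d)
    {a b : Matrix (Fin m) (Fin k) F → ℕ} (ha : ∀ l, 1 ≤ a l) (hb : ∀ l, 1 ≤ b l)
    (hab : ∑ l, a l = ∑ l, b l)
    (hP : ∀ P : ℕ → MvPolynomial (Fin 2) ℤ,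
      ∑ x : Matrix (Fin k) (Fin m) F, P (∑ l, a l * w (x * l)) =
        ∑ x : Matrix (Fin k) (Fin m) F, P (∑ l, b l * w (x * l))) :
    ∑ l, a l * annihilatedCount w d l = ∑ l, b l * annihilatedCount w d l := by
  obtain ⟨f, hf, hfs⟩ := exists_fin_family ha hab
  obtain ⟨g, hg, hgs⟩ := exists_fin_family hb rfl
  by_contra hne
  refine hno ⟨_, matrixCode f, matrixCode g, ?_, ?_, ?_⟩
  · rw [← hab]
    exact (ha 0).trans (Finset.single_le_sum (fun _ _ => Nat.zero_le _) (Finset.mem_univ _))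
  · rw [weightEnumerator_matrixCode w hk f hf, weightEnumerator_matrixCode w hk g hg]
    simp only [fun x : Matrix (Fin k) (Fin m) F => hfs fun l => w (x * l),
      fun x : Matrix (Fin k) (Fin m) F => hgs fun l => w (x * l)]
    exact hP fun s => MvPolynomial.X 0 ^ ((∑ l, b l) * maxWeight w - s) * MvPolynomial.X 1 ^ s
  · rw [weightCount_dualCode_matrixCode hw hk hd hd2, weightCount_dualCode_matrixCode hw hk hd hd2,
      hfs, hgs]
    exact hne

lemma exists_nat_eq_mul {ι : Type*} [Finite ι] (η : ι → ℚ) (hη : ∀ i, 0 < η i) :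
    ∃ (N : ℕ) (a : ι → ℕ), 0 < N ∧ ∀ i, 0 < a i ∧ (a i : ℚ) = N * η i := by
  have := Fintype.ofFinite ι
  classical
  have key : ∀ i, ∃ a : ℕ, (a : ℚ) = ((∏ j, (η j).den : ℕ) : ℚ) * η i := by
    intro i
    refine ⟨(∏ j ∈ Finset.univ.erase i, (η j).den) * (η i).num.toNat, ?_⟩
    have hnum : (((η i).num.toNat : ℕ) : ℚ) = η i * (η i).den := by
      rw [Rat.mul_den_eq_num]
      exact_mod_cast Int.toNat_of_nonneg (Rat.num_nonneg.2 (hη i).le)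
    rw [← Finset.prod_erase_mul _ _ (Finset.mem_univ i)]
    push_cast
    rw [hnum]
    ring
  choose a ha using key
  have hN : 0 < ∏ j, (η j).den := Finset.prod_pos fun j _ => (η j).pos
  refine ⟨_, a, hN, fun i => ⟨?_, ha i⟩⟩
  have : (0 : ℚ) < a i := by
    rw [ha i]
    exact mul_pos (by exact_mod_cast hN) (hη i)
  exact_mod_cast this

/-- The number of matrices of weight `d` that are not annihilated by `l`. -/
noncomputable def survivorCount (w : Matrix (Fin k) (Fin k) F → ℕ) (d : ℕ)
    (l : Matrix (Fin m) (Fin k) F) : ℚ :=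
  annihilatedCount w d (0 : Matrix (Fin m) (Fin k) F) - annihilatedCount w d l

lemma sum_survivorCount_eq_of_not_hasSeparatingPair (hw : IsPositiveWeight w) (hk : 0 < k)
    {d : ℕ} (hd : 0 < d) (hd2 : d < 2 * minWeight w) (hno : ¬ HasSeparatingPair w d)
    {η θ : Matrix (Fin m) (Fin k) F → ℚ} (hη : ∀ l, 0 < η l) (hθ : ∀ l, 0 < θ l)
    (hP : ∀ P : ℚ → MvPolynomial (Fin 2) ℤ,
      ∑ x : Matrix (Fin k) (Fin m) F, P (∑ l, η l * w (x * l)) =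
        ∑ x : Matrix (Fin k) (Fin m) F, P (∑ l, θ l * w (x * l))) :
    ∑ l, η l * survivorCount w d l = ∑ l, θ l * survivorCount w d l := by
  classical
  obtain ⟨N, c, hN, hc⟩ := exists_nat_eq_mul (Sum.elim η θ) (by rintro (l | l); exacts [hη l, hθ l])
  have hNQ : (N : ℚ) ≠ 0 := by exact_mod_cast hN.ne'
  let a := fun l => c (Sum.inl l)
  let b := fun l => c (Sum.inr l)
  have ha : ∀ l, 0 < a l ∧ (a l : ℚ) = N * η l := fun l => hc (Sum.inl l)
  have hb : ∀ l, 0 < b l ∧ (b l : ℚ) = N * θ l := fun l => hc (Sum.inr l)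
  have haux : ∀ (a : Matrix (Fin m) (Fin k) F → ℕ) (t : ℕ) (φ : Matrix (Fin m) (Fin k) F → ℕ),
      ∑ l, (a l + if l = 0 then t else 0) * φ l = ∑ l, a l * φ l + t * φ 0 := by
    intro a t φ
    simp [add_mul, Finset.sum_add_distrib, ite_mul]
  -- Padding each family with as many zero columns as the other has columns equalizes the lengths.
  -- The effect of the padding on the dual count is what `survivorCount` absorbs.
  have hsum := sum_annihilatedCount_eq_of_not_hasSeparatingPair hw hk hd hd2 hno
    (a := fun l => a l + if l = 0 then ∑ l, b l else 0)
    (b := fun l => b l + if l = 0 then ∑ l, a l else 0)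
    (fun l => (ha l).1.trans_le (Nat.le_add_right _ _))
    (fun l => (hb l).1.trans_le (Nat.le_add_right _ _))
    (by simp [Finset.sum_add_distrib, add_comm])
    (by
      intro P
      have h1 : ∀ (a : Matrix (Fin m) (Fin k) F → ℕ) (t : ℕ) (x : Matrix (Fin k) (Fin m) F),
          ∑ l, (a l + if l = 0 then t else 0) * w (x * l) = ∑ l, a l * w (x * l) :=
        fun a t x => by rw [haux a t fun l => w (x * l), Matrix.mul_zero, hw.1, mul_zero, add_zero]
      have h2 := hP fun v => P ⌊(N : ℚ) * v⌋₊
      -- Scaled by `N`, the weights are natural numbers, so the floor recovers them exactly.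
      have h3 : ∀ (a : Matrix (Fin m) (Fin k) F → ℕ) (η : Matrix (Fin m) (Fin k) F → ℚ),
          (∀ l, (a l : ℚ) = N * η l) → ∀ x : Matrix (Fin k) (Fin m) F,
          ⌊(N : ℚ) * ∑ l, η l * w (x * l)⌋₊ = ∑ l, a l * w (x * l) := by
        intro a η h x
        rw [← Nat.floor_natCast (R := ℚ) (∑ l, a l * w (x * l)), Finset.mul_sum]
        push_cast
        simp only [h, mul_assoc]
      simp only [h3 a η fun l => (ha l).2, h3 b θ fun l => (hb l).2] at h2
      simpa only [h1] using h2)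
  rw [haux, haux] at hsum
  have hsumQ : (∑ l, (a l : ℚ) * annihilatedCount w d l) +
      (∑ l, (b l : ℚ)) * annihilatedCount w d (0 : Matrix (Fin m) (Fin k) F) =
      (∑ l, (b l : ℚ) * annihilatedCount w d l) +
      (∑ l, (a l : ℚ)) * annihilatedCount w d (0 : Matrix (Fin m) (Fin k) F) := by
    exact_mod_cast hsum
  simp only [(ha _).2, (hb _).2, mul_assoc, ← Finset.mul_sum] at hsumQ
  apply mul_left_cancel₀ hNQ
  simp only [survivorCount, mul_sub, Finset.sum_sub_distrib, ← Finset.sum_mul]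
  linear_combination -hsumQ

end Codes

/-! ### Sizes of kernel fibres -/

section KernelFiber

variable {F : Type*} [Field F] [Fintype F] {k m : ℕ}

open Classical in
/-- The set of `k × m` matrices with a given kernel. -/
noncomputable def kernelFiber (k : ℕ) (K : Submodule F (Fin m → F)) :
    Finset (Matrix (Fin k) (Fin m) F) :=
  {x | LinearMap.ker x.mulVecLin = K}

lemma mem_kernelFiber {K : Submodule F (Fin m → F)} {x : Matrix (Fin k) (Fin m) F} :
    x ∈ kernelFiber k K ↔ LinearMap.ker x.mulVecLin = K := by simp [kernelFiber]

/-- A matrix with kernel `K` is an injective map on the quotient by `K`, given by independent images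
of a basis. -/
lemma card_kernelFiber_eq_card_linearIndependent (K : Submodule F (Fin m → F)) :
    (kernelFiber k K).card = Nat.card {s : Fin (finrank F ((Fin m → F) ⧸ K)) → Fin k → F //
      LinearIndependent F s} := by
  classical
  let b := Module.finBasis F ((Fin m → F) ⧸ K)
  have hker : ∀ s : Fin (finrank F ((Fin m → F) ⧸ K)) → Fin k → F, LinearIndependent F s →
      LinearMap.ker (LinearMap.toMatrix' (b.constr F s ∘ₗ K.mkQ)).mulVecLin = K := by
    intro s hs
    have hbot : LinearMap.ker (b.constr F s) = ⊥ := by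
      rw [LinearMap.ker_eq_bot']
      intro y hy
      rw [Module.Basis.constr_apply_fintype] at hy
      apply b.ext_elem
      intro i
      rw [map_zero]
      exact Fintype.linearIndependent_iff.1 hs _ hy i
    rw [← Matrix.toLin'_apply', Matrix.toLin'_toMatrix', LinearMap.ker_comp, hbot,
      ← LinearMap.ker, Submodule.ker_mkQ]
  rw [← Nat.card_eq_finsetCard]
  symm
  refine Nat.card_congr (Equiv.ofBijective
    (fun s => ⟨_, mem_kernelFiber.2 (hker s.1 s.2)⟩) ⟨?_, ?_⟩)
  · intro s t h
    have h1 := LinearMap.toMatrix'.injective (congrArg Subtype.val h)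
    have h2 := (LinearMap.cancel_right K.mkQ_surjective).1 h1
    exact Subtype.ext ((b.constr F).injective h2)
  · rintro ⟨x, hx⟩
    have hx' := mem_kernelFiber.1 hx
    let f := K.liftQ x.mulVecLin hx'.ge
    have hf : LinearMap.ker f = ⊥ := Submodule.ker_liftQ_eq_bot _ _ _ hx'.le
    refine ⟨⟨fun i => f (b i), b.linearIndependent.map' f hf⟩, Subtype.ext ?_⟩
    have hc : b.constr F (fun i => f (b i)) = f := b.ext fun i => by rw [b.constr_basis]
    change LinearMap.toMatrix' (b.constr F (fun i => f (b i)) ∘ₗ K.mkQ) = x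
    rw [hc, Submodule.liftQ_mkQ, ← Matrix.toLin'_apply', LinearMap.toMatrix'_toLin']

/-- The size is `∏ (q^k - q^i)`, whose factor at `i = 0` is `q^k - 1`, or zero if the codimension
exceeds `k`. The bound on `t` does not involve `m`, so `m` can later be chosen beyond it. -/
lemma exists_card_kernelFiber_eq {K : Submodule F (Fin m → F)} (hK : K ≠ ⊤) :
    ∃ t ≤ (Fintype.card F ^ k) ^ k,
      (kernelFiber k K).card = t * (Fintype.card F ^ k - 1) := by
  rw [card_kernelFiber_eq_card_linearIndependent]
  set j := finrank F ((Fin m → F) ⧸ K)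
  have hj : 0 < j := by
    rw [Module.finrank_pos_iff]
    exact Submodule.Quotient.nontrivial_iff.2 hK
  rcases le_or_gt j k with hjk | hjk
  · have h1 := card_linearIndependent (K := F) (V := Fin k → F) (k := j) (by simpa using hjk)
    have hdvd : Fintype.card F ^ k - 1 ∣
        Nat.card {s : Fin j → Fin k → F // LinearIndependent F s} := by
      rw [h1]
      have := Finset.dvd_prod_of_mem
        (fun i : Fin j => Fintype.card F ^ finrank F (Fin k → F) - Fintype.card F ^ (i : ℕ))
        (Finset.mem_univ ⟨0, hj⟩)
      simpa using this
    obtain ⟨t, ht⟩ := hdvd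
    refine ⟨t, ?_, by rw [ht, mul_comm]⟩
    have hpos : 0 < Fintype.card F ^ k - 1 :=
      Nat.sub_pos_of_lt (Nat.one_lt_pow (by omega) Fintype.one_lt_card)
    calc t ≤ (Fintype.card F ^ k - 1) * t := Nat.le_mul_of_pos_left t hpos
      _ = Nat.card {s : Fin j → Fin k → F // LinearIndependent F s} := ht.symm
      _ ≤ Nat.card (Fin j → Fin k → F) := Finite.card_subtype_le _
      _ = (Fintype.card F ^ k) ^ j := by simp [Nat.card_eq_fintype_card]
      _ ≤ _ := Nat.pow_le_pow_right (Nat.pow_pos Fintype.card_pos) hjk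
  · refine ⟨0, Nat.zero_le _, ?_⟩
    rw [zero_mul, Nat.card_eq_zero]
    left
    refine ⟨fun s => ?_⟩
    have := s.2.fintype_card_le_finrank
    simp at this
    omega

lemma card_kernelFiber_of_finrank_eq_one (hk : 0 < k) {K : Submodule F (Fin m → F)}
    (hK : finrank F ((Fin m → F) ⧸ K) = 1) :
    (kernelFiber k K).card = Fintype.card F ^ k - 1 := by
  rw [card_kernelFiber_eq_card_linearIndependent, hK,
    card_linearIndependent (K := F) (V := Fin k → F) (k := 1) (by simpa using Nat.one_le_iff_ne_zero.2 hk.ne')]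
  simp

end KernelFiber

/-! ### Linear relations between survivor counts -/

section Relations

variable {F : Type*} [Field F] [Fintype F] {k m : ℕ} {w : Matrix (Fin k) (Fin k) F → ℕ}

lemma exists_pos_add {H : Type*} [Fintype H] {η : H → ℚ} (hη : ∀ l, 1 ≤ η l) (ε θ : H → ℚ) :
    ∃ N : ℚ, (∀ l, 0 < N * η l + ε l) ∧ ∀ l, 0 < N * η l + θ l := by
  have key : ∀ (ε θ : H → ℚ) (l : H), 0 < (1 + ∑ h, |ε h| + ∑ h, |θ h|) * η l + ε l := by
    intro ε θ l
    have h1 : |ε l| ≤ ∑ h, |ε h| :=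
      Finset.single_le_sum (f := fun h => |ε h|) (fun _ _ => abs_nonneg _) (Finset.mem_univ l)
    have h2 : 0 ≤ ∑ h, |θ h| := Finset.sum_nonneg fun _ _ => abs_nonneg _
    have h3 := neg_abs_le (ε l)
    have h4 : 1 + ∑ h, |ε h| + ∑ h, |θ h| ≤ (1 + ∑ h, |ε h| + ∑ h, |θ h|) * η l :=
      le_mul_of_one_le_right (by linarith [abs_nonneg (ε l)]) (hη l)
    linarith
  refine ⟨1 + ∑ h, |ε h| + ∑ h, |θ h|, key ε θ, fun l => ?_⟩
  have := key θ ε l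
  rwa [add_right_comm] at this

/-- Moving a small additional weight from one set of codewords to another one of the same size, on
both of which the weight is the same constant, does not change the survivor count. -/
lemma sum_survivorCount_eq_of_indicator (hw : IsPositiveWeight w) (hk : 0 < k)
    {d : ℕ} (hd : 0 < d) (hd2 : d < 2 * minWeight w) (hno : ¬ HasSeparatingPair w d)
    {S T : Finset (Matrix (Fin k) (Fin m) F)} (hST : S.card = T.card)
    {η ε θ : Matrix (Fin m) (Fin k) F → ℚ} (hη : ∀ l, 1 ≤ η l) (b : ℚ)
    (hS : ∀ x ∈ S, ∑ l, η l * (w (x * l) : ℚ) = b) (hT : ∀ x ∈ T, ∑ l, η l * (w (x * l) : ℚ) = b)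
    (hε : ∀ x ∈ S, ∑ l, ε l * (w (x * l) : ℚ) = 1) (hε' : ∀ x ∉ S, ∑ l, ε l * (w (x * l) : ℚ) = 0)
    (hθ : ∀ x ∈ T, ∑ l, θ l * (w (x * l) : ℚ) = 1) (hθ' : ∀ x ∉ T, ∑ l, θ l * (w (x * l) : ℚ) = 0) :
    ∑ l, ε l * survivorCount w d l = ∑ l, θ l * survivorCount w d l := by
  classical
  obtain ⟨N, h1, h2⟩ := exists_pos_add hη ε θ
  -- Adding `ε` raises the weight from `N * b` to `N * b + 1` on `S` and changes nothing elsewhere,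
  -- so only `S.card` matters.
  have key : ∀ {S : Finset (Matrix (Fin k) (Fin m) F)} {ε : Matrix (Fin m) (Fin k) F → ℚ},
      (∀ x ∈ S, ∑ l, η l * (w (x * l) : ℚ) = b) → (∀ x ∈ S, ∑ l, ε l * (w (x * l) : ℚ) = 1) →
      (∀ x ∉ S, ∑ l, ε l * (w (x * l) : ℚ) = 0) → ∀ P : ℚ → MvPolynomial (Fin 2) ℤ,
      ∑ x : Matrix (Fin k) (Fin m) F, P (∑ l, (N * η l + ε l) * w (x * l)) =
        S.card • (P (N * b + 1) - P (N * b)) +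
          ∑ x : Matrix (Fin k) (Fin m) F, P (N * ∑ l, η l * w (x * l)) := by
    intro S ε hS hε hε' P
    rw [← sub_eq_iff_eq_add, ← Finset.sum_sub_distrib, ← Finset.sum_const,
      ← Finset.sum_subset (Finset.subset_univ S)]
    · refine Finset.sum_congr rfl fun x hx => ?_
      simp only [add_mul, mul_assoc, Finset.sum_add_distrib, ← Finset.mul_sum]
      rw [hS x hx, hε x hx]
    · intro x _ hx
      simp only [add_mul, mul_assoc, Finset.sum_add_distrib, ← Finset.mul_sum]
      rw [hε' x hx, add_zero, sub_self]
  have h3 := sum_survivorCount_eq_of_not_hasSeparatingPair hw hk hd hd2 hno h1 h2 fun P => by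
    rw [key hS hε hε', key hT hθ hθ', hST]
  simpa [add_mul, Finset.sum_add_distrib] using h3

variable (hsym : HasMaximalSymmetry w)
include hsym

/-- The rank of `x * l` is `k` minus the dimension of the preimage of `ker x` under `l`. -/
lemma apply_mul_eq_of_ker_eq {x y : Matrix (Fin k) (Fin m) F}
    (h : LinearMap.ker x.mulVecLin = LinearMap.ker y.mulVecLin) (l : Matrix (Fin m) (Fin k) F) :
    w (x * l) = w (y * l) := by
  have hrank : ∀ x : Matrix (Fin k) (Fin m) F, (x * l).rank +
      finrank F ((LinearMap.ker x.mulVecLin).comap l.mulVecLin) = k := by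
    intro x
    have := LinearMap.finrank_range_add_finrank_ker (x * l).mulVecLin
    rw [Matrix.mulVecLin_mul, LinearMap.ker_comp, Module.finrank_fin_fun] at this
    rw [Matrix.rank, Matrix.mulVecLin_mul]
    exact this
  have h1 := hrank x
  have h2 := hrank y
  rw [h] at h1
  rw [apply_eq_rankValue hsym, apply_eq_rankValue hsym (y * l)]
  congr 1
  omega

lemma exists_weight_mul_eq_ite (hk : 0 < k) (v : Fin m → F) :
    ∃ l : Matrix (Fin m) (Fin k) F, ∀ x : Matrix (Fin k) (Fin m) F,
      (x.mulVec v = 0 → x * l = 0) ∧ (x.mulVec v ≠ 0 → w (x * l) = rankValue w 1) := by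
  refine ⟨Matrix.vecMulVec v (Pi.single ⟨0, hk⟩ 1), fun x => ⟨fun h => ?_, fun h => ?_⟩⟩
  · rw [Matrix.mul_vecMulVec, h, Matrix.zero_vecMulVec]
  · rw [apply_eq_rankValue hsym]
    rw [Matrix.mul_vecMulVec]
    refine congrArg _ (le_antisymm (Matrix.rank_vecMulVec_le _ _) ?_)
    rw [Nat.one_le_iff_ne_zero, Ne, Matrix.rank, Submodule.finrank_eq_zero,
      LinearMap.range_eq_bot]
    intro h0
    apply h
    have h1 := LinearMap.congr_fun h0 (Pi.single ⟨0, hk⟩ 1)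
    ext i
    simpa [Matrix.vecMulVec_apply] using congrFun h1 i

/-- Independent kernels admit positive multiplicities for which the weight is the same on all of
them. -/
lemma exists_constant_weight (hw : IsPositiveWeight w) (hk : 0 < k) {ι : Type*} [Fintype ι]
    {S : ι → Submodule F (Fin m → F)} {v : ι → Fin m → F} (hv : ∀ i, v i ∉ S i)
    (hv' : ∀ i j, i ≠ j → v i ∈ S j) :
    ∃ (η : Matrix (Fin m) (Fin k) F → ℚ) (b : ℚ), (∀ l, 1 ≤ η l) ∧
      ∀ i, ∀ x ∈ kernelFiber k (S i), ∑ l, η l * (w (x * l) : ℚ) = b := by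
  classical
  choose l hl0 hl1 using fun i => exists_weight_mul_eq_ite hsym hk (v i)
  let β : Matrix (Fin k) (Fin m) F → ℚ := fun x => ∑ l : Matrix (Fin m) (Fin k) F, (w (x * l) : ℚ)
  have hβ : ∀ x, 0 ≤ β x := fun x => Finset.sum_nonneg fun _ _ => Nat.cast_nonneg _
  let total : ℚ := ∑ x, β x
  have hβt : ∀ x, β x ≤ total := fun x =>
    Finset.single_le_sum (fun x _ => hβ x) (Finset.mem_univ x)
  let rep : ι → Matrix (Fin k) (Fin m) F := fun i =>
    if h : (kernelFiber k (S i)).Nonempty then h.choose else 0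
  have hrep : ∀ i, ∀ x ∈ kernelFiber k (S i), β x = β (rep i) := by
    intro i x hx
    have h : (kernelFiber k (S i)).Nonempty := ⟨x, hx⟩
    simp only [β, rep, dif_pos h]
    refine Finset.sum_congr rfl fun l _ => ?_
    rw [apply_mul_eq_of_ker_eq hsym
      ((mem_kernelFiber.1 hx).trans (mem_kernelFiber.1 h.choose_spec).symm)]
  rcases isEmpty_or_nonempty ι with hι | ⟨⟨i₀⟩⟩
  · exact ⟨1, 0, fun _ => le_rfl, fun i => (hι.false i).elim⟩
  have hw1 : 1 ≤ rankValue w 1 := by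
    refine Nat.one_le_iff_ne_zero.2 fun h => ?_
    have h0 : Matrix.diagonal (fun i : Fin k => if (i : ℕ) < 1 then (1 : F) else 0) = 0 := by
      by_contra hne
      exact (hw.2 _ hne).ne' h
    have h1 := congrFun (congrFun h0 ⟨0, hk⟩) ⟨0, hk⟩
    simp at h1
  -- The constant multiplicity `w_1` gives the weight `w_1 * β`. The extra multiplicity at `l i`
  -- adds `w_1 * (total - β)` on the fibre of `S i` and nothing on the other fibres.
  refine ⟨fun h => rankValue w 1 + ∑ i, if h = l i then total - β (rep i) else 0,
    rankValue w 1 * total, fun h => ?_, fun i x hx => ?_⟩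
  · have h1 : (1 : ℚ) ≤ rankValue w 1 := by exact_mod_cast hw1
    refine h1.trans (le_add_of_nonneg_right (Finset.sum_nonneg fun i _ => ?_))
    split_ifs
    · exact sub_nonneg.2 (hβt _)
    · exact le_rfl
  · have hker := mem_kernelFiber.1 hx
    have hmem : ∀ u, u ∈ S i ↔ x.mulVec u = 0 := fun u => by
      rw [← hker, LinearMap.mem_ker, Matrix.mulVecLin_apply]
    have h1 : ∀ j, (w (x * l j) : ℚ) = if j = i then (rankValue w 1 : ℚ) else 0 := by
      intro j
      split_ifs with hj
      · subst hj
        rw [hl1 j x fun h => hv j ((hmem _).2 h)]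
      · rw [hl0 j x ((hmem _).1 (hv' j i hj)), hw.1, Nat.cast_zero]
    simp only [add_mul, Finset.sum_add_distrib, ← Finset.mul_sum, Finset.sum_mul]
    rw [Finset.sum_comm]
    simp only [ite_mul, zero_mul, Finset.sum_ite_eq', Finset.mem_univ, if_true, h1, mul_ite,
      mul_zero]
    change (rankValue w 1 : ℚ) * β x + _ = _
    rw [hrep i x hx]
    ring

open Classical in
/-- The relation between the survivor counts for independent kernels. -/
lemma sum_survivorCount_eq_sum_of_independent (hw : IsPositiveWeight w) (hk : 0 < k)
    {d : ℕ} (hd : 0 < d) (hd2 : d < 2 * minWeight w) (hno : ¬ HasSeparatingPair w d)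
    {ε : Submodule F (Fin m → F) → Matrix (Fin m) (Fin k) F → ℚ}
    (hε : ∀ K ≠ ⊤, ∀ x : Matrix (Fin k) (Fin m) F, ∑ l, ε K l * (w (x * l) : ℚ) =
      if x ∈ kernelFiber k K then 1 else 0)
    {ι : Type*} [Fintype ι] {K : Submodule F (Fin m → F)} {S : ι → Submodule F (Fin m → F)}
    {v₀ : Fin m → F} {v : ι → Fin m → F} (hv₀ : v₀ ∉ K) (hv₀' : ∀ i, v₀ ∈ S i)
    (hv : ∀ i, v i ∉ S i) (hvK : ∀ i, v i ∈ K) (hv' : ∀ i j, i ≠ j → v i ∈ S j)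
    (hcard : (kernelFiber k K).card = ∑ i, (kernelFiber k (S i)).card) :
    ∑ l, ε K l * survivorCount w d l = ∑ i, ∑ l, ε (S i) l * survivorCount w d l := by
  -- The index `none` stands for `K`, so that its fibre gets the same constant weight as the fibres
  -- of the `S i`.
  obtain ⟨η, b, hη, hb⟩ := exists_constant_weight (k := k) hsym hw hk
    (S := fun o : Option ι => o.elim K S) (v := fun o => o.elim v₀ v)
    (by rintro (_ | i); exacts [hv₀, hv i])
    (by
      rintro (_ | i) (_ | j) hij
      exacts [(hij rfl).elim, hv₀' j, hvK i, hv' i j fun h => hij (congrArg some h)])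
  have hdisj : ∀ x : Matrix (Fin k) (Fin m) F, ∀ i, x ∈ kernelFiber k (S i) →
      ∀ j, x ∈ kernelFiber k (S j) → j = i := by
    intro x i hi j hj
    by_contra hij
    apply hv i
    rw [← mem_kernelFiber.1 hi, mem_kernelFiber.1 hj]
    exact hv' i j (Ne.symm hij)
  have hKtop : K ≠ ⊤ := fun h => hv₀ (h ▸ Submodule.mem_top)
  have hStop : ∀ i, S i ≠ ⊤ := fun i h => hv i (h ▸ Submodule.mem_top)
  have hθ : ∀ x : Matrix (Fin k) (Fin m) F, ∑ l, (∑ i, ε (S i) l) * (w (x * l) : ℚ) =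
      ∑ i, if x ∈ kernelFiber k (S i) then 1 else 0 := by
    intro x
    simp only [Finset.sum_mul]
    rw [Finset.sum_comm]
    exact Finset.sum_congr rfl fun i _ => hε (S i) (hStop i) x
  have h := sum_survivorCount_eq_of_indicator hw hk hd hd2 hno
    (S := kernelFiber k K) (T := Finset.univ.biUnion fun i => kernelFiber k (S i))
    (ε := ε K) (θ := fun l => ∑ i, ε (S i) l) ?_ hη b (hb none) ?_ ?_ ?_ ?_ ?_
  · rw [h]
    simp only [Finset.sum_mul]
    exact Finset.sum_comm
  · rw [hcard, Finset.card_biUnion]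
    intro i _ j _ hij
    rw [Function.onFun, Finset.disjoint_left]
    exact fun x hi hj => hij (hdisj x j hj i hi)
  · intro x hx
    obtain ⟨i, _, hi⟩ := Finset.mem_biUnion.1 hx
    exact hb (some i) x hi
  · intro x hx
    rw [hε K hKtop, if_pos hx]
  · intro x hx
    rw [hε K hKtop, if_neg hx]
  · intro x hx
    obtain ⟨i, _, hi⟩ := Finset.mem_biUnion.1 hx
    rw [hθ, Finset.sum_eq_single i, if_pos hi]
    · intro j _ hj
      exact if_neg fun hxj => hj (hdisj x i hi j hxj)
    · simp
  · intro x hx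
    rw [hθ]
    refine Finset.sum_eq_zero fun i _ => if_neg fun hi => hx ?_
    exact Finset.mem_biUnion.2 ⟨i, Finset.mem_univ _, hi⟩

end Relations

/-! ### Proportionality of survivor count and total weight -/

section Proportional

variable {F : Type*} [Field F] [Fintype F] {k m : ℕ} {w : Matrix (Fin k) (Fin k) F → ℕ}

lemma finrank_quotient_ker_eq_one {V : Type*} [AddCommGroup V] [Module F V] {φ : V →ₗ[F] F}
    {v : V} (h : φ v = 1) : finrank F (V ⧸ LinearMap.ker φ) = 1 := by
  have hs : Function.Surjective φ := fun c => ⟨c • v, by rw [map_smul, h, smul_eq_mul, mul_one]⟩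
  rw [(φ.quotKerEquivOfSurjective hs).finrank_eq, finrank_self]

/-- A vector outside `K` and `t` basis vectors of `K` are independent; `S i` is the kernel of a
functional dual to `v i`. -/
lemma exists_independent_hyperplanes {V : Type*} [AddCommGroup V] [Module F V] [Finite V]
    {K : Submodule F V} (hK : K ≠ ⊤) {t : ℕ} (ht : t ≤ finrank F K) :
    ∃ (S : Fin t → Submodule F V) (v₀ : V) (v : Fin t → V), v₀ ∉ K ∧ (∀ i, v₀ ∈ S i) ∧
      (∀ i, v i ∉ S i) ∧ (∀ i, v i ∈ K) ∧ (∀ i j, i ≠ j → v i ∈ S j) ∧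
      ∀ i, finrank F (V ⧸ S i) = 1 := by
  obtain ⟨v₀, hv₀⟩ : ∃ v₀, v₀ ∉ K := by
    by_contra h
    push Not at h
    exact hK (eq_top_iff.2 fun x _ => h x)
  let b := Module.finBasis F K
  let v : Fin t → V := fun i => b (Fin.castLE ht i)
  have hvK : ∀ i, v i ∈ K := fun i => (b _).2
  have hv : LinearIndependent F v :=
    (b.linearIndependent.map' K.subtype K.ker_subtype).comp _ (Fin.castLE_injective ht)
  have hli : LinearIndependent F (fun o : Option (Fin t) => Option.casesOn' o v₀ v) :=
    hv.option fun h => hv₀ (Submodule.span_le.2 (by rintro _ ⟨i, rfl⟩; exact hvK i) h)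
  have hφ : ∀ o : Option (Fin t), ∃ φ : V →ₗ[F] F, ∀ p : Option (Fin t),
      φ (Option.casesOn' p v₀ v) = if p = o then 1 else 0 := by
    intro o
    obtain ⟨φ, hφ⟩ := ((Finsupp.lapply o).comp hli.repr).exists_extend
    refine ⟨φ, fun p => ?_⟩
    have h1 := LinearMap.congr_fun hφ ⟨_, Submodule.subset_span ⟨p, rfl⟩⟩
    rw [LinearMap.comp_apply, Submodule.subtype_apply] at h1
    rw [h1, LinearMap.comp_apply,
      hli.repr_eq_single p ⟨_, Submodule.subset_span ⟨p, rfl⟩⟩ rfl, Finsupp.lapply_apply,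
      Finsupp.single_apply]
  choose φ hφ using hφ
  refine ⟨fun i => LinearMap.ker (φ (some i)), v₀, v, hv₀, fun i => ?_, fun i => ?_, hvK,
    fun i j hij => ?_, fun i => ?_⟩
  · simpa using hφ (some i) none
  · have := hφ (some i) (some i)
    simp only [Option.casesOn'_some, if_true] at this
    rw [LinearMap.mem_ker, this]
    exact one_ne_zero
  · simpa [hij] using hφ (some j) (some i)
  · refine finrank_quotient_ker_eq_one (v := v i) ?_
    simpa using hφ (some i) (some i)

lemma exists_notMem_of_finrank_quotient_eq_one {V : Type*} [AddCommGroup V] [Module F V] [Finite V]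
    {H H' : Submodule F V} (h : finrank F (V ⧸ H) = 1) (h' : finrank F (V ⧸ H') = 1)
    (hne : H ≠ H') : ∃ v ∈ H, v ∉ H' := by
  by_contra hcon
  push Not at hcon
  have h1 := Submodule.finrank_quotient_add_finrank H
  have h2 := Submodule.finrank_quotient_add_finrank H'
  exact hne (Submodule.eq_of_le_of_finrank_eq hcon (by omega))

variable (hsym : HasMaximalSymmetry w)
include hsym

/-- If no pair of codes separates, then the survivor count is proportional to the average weight. -/
lemma exists_survivorCount_eq_mul_sum (hw : IsPositiveWeight w) (hnd : IsNondegenerate w)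
    (hk : 0 < k) {d : ℕ} (hd : 0 < d) (hd2 : d < 2 * minWeight w)
    (hno : ¬ HasSeparatingPair w d) (hm : k + (Fintype.card F ^ k) ^ k ≤ m) :
    ∃ c : ℚ, ∀ l : Matrix (Fin m) (Fin k) F,
      survivorCount w d l = c * ∑ x : Matrix (Fin k) (Fin m) F, (w (x * l) : ℚ) := by
  classical
  have hex : ∀ K : Submodule F (Fin m → F), ∃ ε : Matrix (Fin m) (Fin k) F → ℚ, K ≠ ⊤ →
      ∀ x : Matrix (Fin k) (Fin m) F, ∑ l, ε l * (w (x * l) : ℚ) =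
        if x ∈ kernelFiber k K then 1 else 0 := by
    intro K
    by_cases hK : K = ⊤
    · exact ⟨0, fun h => (h hK).elim⟩
    · obtain ⟨ε, hε⟩ := exists_sum_mul_eq_ite_ker (k := k) hsym hnd hK
      exact ⟨ε, fun _ x => by rw [hε x]; simp only [mem_kernelFiber]⟩
  choose ε hε using hex
  set G : Submodule F (Fin m → F) → ℚ := fun K => ∑ l, ε K l * survivorCount w d l with hG
  have hq : (0 : ℚ) < ((Fintype.card F ^ k - 1 : ℕ) : ℚ) := by
    exact_mod_cast Nat.sub_pos_of_lt (Nat.one_lt_pow hk.ne' Fintype.one_lt_card)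
  have hone : ∀ H H' : Submodule F (Fin m → F), finrank F ((Fin m → F) ⧸ H) = 1 →
      finrank F ((Fin m → F) ⧸ H') = 1 → G H = G H' := by
    intro H H' h h'
    by_cases hne : H = H'
    · rw [hne]
    obtain ⟨v, hv, hv'⟩ := exists_notMem_of_finrank_quotient_eq_one h h' hne
    obtain ⟨v₀, hv₀, hv₀'⟩ := exists_notMem_of_finrank_quotient_eq_one h' h (Ne.symm hne)
    have := sum_survivorCount_eq_sum_of_independent hsym hw hk hd hd2 hno hε (K := H)
      (S := fun _ : Unit => H') (v := fun _ => v) hv₀' (fun _ => hv₀) (fun _ => hv')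
      (fun _ => hv) (fun i j hij => (hij (Subsingleton.elim _ _)).elim)
      (by simp [card_kernelFiber_of_finrank_eq_one hk h, card_kernelFiber_of_finrank_eq_one hk h'])
    simpa using this
  obtain ⟨c, hc⟩ : ∃ c : ℚ, ∀ H : Submodule F (Fin m → F), finrank F ((Fin m → F) ⧸ H) = 1 →
      G H = c * ((Fintype.card F ^ k - 1 : ℕ) : ℚ) := by
    by_cases h : ∃ H : Submodule F (Fin m → F), finrank F ((Fin m → F) ⧸ H) = 1
    · obtain ⟨H, hH⟩ := h
      refine ⟨G H / ((Fintype.card F ^ k - 1 : ℕ) : ℚ), fun H' hH' => ?_⟩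
      rw [div_mul_cancel₀ _ hq.ne', hone H H' hH hH']
    · exact ⟨0, fun H hH => (h ⟨H, hH⟩).elim⟩
  have hGK : ∀ K : Submodule F (Fin m → F), K ≠ ⊤ → G K = c * ((kernelFiber k K).card : ℚ) := by
    intro K hK
    obtain ⟨t, htb, ht⟩ := exists_card_kernelFiber_eq (k := k) hK
    -- A nonempty fibre forces `K` to have codimension at most `k`, and then the choice of `m`
    -- leaves room for `t` independent vectors. An empty fibre has `t = 0`.
    have htK : t ≤ finrank F K := by
      rcases (kernelFiber k K).eq_empty_or_nonempty with h | ⟨x, hx⟩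
      · rw [h, Finset.card_empty, eq_comm, mul_eq_zero] at ht
        rcases ht with ht | ht
        · omega
        · simp [ht] at hq
      · have h1 := LinearMap.finrank_range_add_finrank_ker x.mulVecLin
        have h2 := (LinearMap.range x.mulVecLin).finrank_le
        rw [mem_kernelFiber.1 hx, Module.finrank_fin_fun] at h1
        rw [Module.finrank_fin_fun] at h2
        omega
    obtain ⟨S, v₀, v, hv₀, hv₀', hv, hvK, hv', hS⟩ := exists_independent_hyperplanes hK htK
    rw [hG]
    change ∑ l, ε K l * survivorCount w d l = _
    rw [sum_survivorCount_eq_sum_of_independent hsym hw hk hd hd2 hno hε (K := K) (S := S)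
      hv₀ hv₀' hv hvK hv' (by simp [ht, fun i => card_kernelFiber_of_finrank_eq_one hk (hS i)]),
      ht, Finset.sum_congr rfl fun i _ => hc (S i) (hS i)]
    simp
    ring
  refine ⟨c, fun l => ?_⟩
  let val : Submodule F (Fin m → F) → ℚ := fun K =>
    if h : (kernelFiber k K).Nonempty then (w (h.choose * l) : ℚ) else 0
  have hval : ∀ K, ∀ x ∈ kernelFiber k K, (w (x * l) : ℚ) = val K := by
    intro K x hx
    have h : (kernelFiber k K).Nonempty := ⟨x, hx⟩
    simp only [val, dif_pos h]
    rw [apply_mul_eq_of_ker_eq hsym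
      ((mem_kernelFiber.1 hx).trans (mem_kernelFiber.1 h.choose_spec).symm)]
  have htop : val ⊤ = 0 := by
    have h0 : (0 : Matrix (Fin k) (Fin m) F) ∈ kernelFiber k ⊤ := by
      rw [mem_kernelFiber, Matrix.mulVecLin_zero, LinearMap.ker_zero]
    rw [← hval ⊤ 0 h0, Matrix.zero_mul, hw.1, Nat.cast_zero]
  -- The unit multiplicity at `l` minus `∑ K, val K * ε K` gives weight zero to every `x`. Comparing
  -- it with `θ = 0` on empty sets shows that its survivor functional vanishes.
  have hlin : ∑ h, ((if h = l then 1 else 0) - ∑ K with K ≠ ⊤, val K * ε K h) *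
      survivorCount w d h = 0 := by
    have := sum_survivorCount_eq_of_indicator (S := (∅ : Finset (Matrix (Fin k) (Fin m) F)))
      (T := ∅) hw hk hd hd2 hno rfl
      (ε := fun h => (if h = l then 1 else 0) - ∑ K with K ≠ ⊤, val K * ε K h) (θ := 0)
      (η := 1) (fun _ => le_rfl) 0 (by simp) (by simp) (by simp) ?_ (by simp) (by simp)
    · simpa using this
    · intro x _
      simp only [sub_mul, Finset.sum_sub_distrib, ite_mul, one_mul, zero_mul, Finset.sum_ite_eq',
        Finset.mem_univ, if_true, Finset.sum_mul]
      rw [Finset.sum_comm, sub_eq_zero, hval _ x (mem_kernelFiber.2 rfl)]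
      simp only [mul_assoc, ← Finset.mul_sum]
      rw [Finset.sum_congr rfl fun K hK => by
        rw [hε K (Finset.mem_filter.1 hK).2 x], Finset.sum_filter]
      simp only [mem_kernelFiber, mul_ite, mul_one, mul_zero]
      rw [Finset.sum_eq_single (LinearMap.ker x.mulVecLin)]
      · by_cases h : LinearMap.ker x.mulVecLin = ⊤
        · simp [h, htop]
        · simp [h]
      · intro K _ hK
        simp [Ne.symm hK]
      · simp
  simp only [sub_mul, Finset.sum_sub_distrib, ite_mul, one_mul, zero_mul, Finset.sum_ite_eq',
    Finset.mem_univ, if_true, Finset.sum_mul] at hlin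
  rw [sub_eq_zero, Finset.sum_comm] at hlin
  simp only [mul_assoc, ← Finset.mul_sum] at hlin
  rw [hlin, ← Finset.sum_fiberwise Finset.univ
    (fun x : Matrix (Fin k) (Fin m) F => LinearMap.ker x.mulVecLin), Finset.mul_sum,
    Finset.sum_filter]
  refine Finset.sum_congr rfl fun K _ => ?_
  have hfib : ∑ x : Matrix (Fin k) (Fin m) F with LinearMap.ker x.mulVecLin = K, (w (x * l) : ℚ) =
      (kernelFiber k K).card * val K := by
    rw [← nsmul_eq_mul, ← Finset.sum_const]
    exact Finset.sum_congr (by ext x; simp [mem_kernelFiber])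
      fun x hx => hval K x (mem_kernelFiber.2 (Finset.mem_filter.1 hx).2)
  rw [hfib]
  split_ifs with hK
  · change val K * G K = _
    rw [hGK K hK]
    ring
  · rw [not_not] at hK
    rw [hK, htop]
    ring

end Proportional

/-! ### The contradiction -/

section Main

variable {F : Type*} [Field F] [Fintype F] {k m : ℕ} {w : Matrix (Fin k) (Fin k) F → ℕ}

/-- Setting the first variable to `1` makes the weight count a coefficient. -/
lemma weightCount_eq_of_weightEnumerator_eq {R : Type*} [Ring R] [Fintype R] {w : R → ℕ} {n : ℕ}
    {C D : Set (Fin n → R)} (h : weightEnumerator w C = weightEnumerator w D) (d : ℕ) :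
    weightCount w C d = weightCount w D d := by
  classical
  have key : ∀ C : Set (Fin n → R), (weightCount w C d : ℤ) =
      (MvPolynomial.aeval ![(1 : Polynomial ℤ), Polynomial.X] (weightEnumerator w C)).coeff d := by
    intro C
    rw [weightEnumerator, map_sum, Polynomial.finsetSum_coeff, weightCount,
      Set.ncard_eq_toFinset_card', Set.toFinset_ofPred, ← Finset.filter_filter,
      Finset.card_filter]
    push_cast
    refine Finset.sum_congr (by congr) fun x _ => ?_
    simp [Polynomial.coeff_X_pow, eq_comm]
  have := key C
  rw [h, ← key D] at this
  exact_mod_cast this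

lemma annihilatedCount_mul_left {l : Matrix (Fin m) (Fin k) F} {κ : Matrix (Fin k) (Fin m) F}
    (h : κ * l = 1) (d : ℕ) (p : Matrix (Fin k) (Fin k) F) :
    annihilatedCount w d (l * p) = annihilatedCount w d p := by
  classical
  simp only [annihilatedCount]
  congr 1
  ext r
  simp only [Finset.mem_filter, Finset.mem_univ, true_and]
  refine and_congr_right fun _ => ⟨fun h0 => ?_, fun h0 => ?_⟩
  · rw [← Matrix.one_mul (p * r), ← h, Matrix.mul_assoc, ← Matrix.mul_assoc l, h0,
      Matrix.mul_zero]
  · rw [Matrix.mul_assoc, h0, Matrix.mul_zero]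

/-- The transpose is `u * p * v` for units `u`, `v`, and `r ↦ v * r` preserves the weight. It lets
annihilation be read as the range of `p` lying in the kernel of the transpose of `r`. -/
lemma annihilatedCount_transpose (hsym : HasMaximalSymmetry w) (d : ℕ)
    (p : Matrix (Fin k) (Fin k) F) :
    annihilatedCount w d p.transpose = annihilatedCount w d p := by
  classical
  obtain ⟨u, v, huv⟩ := exists_units_mul_mul_eq p.rank_transpose.symm
  simp only [annihilatedCount]
  refine Finset.card_equiv v.mulLeft fun r => ?_
  simp only [Finset.mem_filter, Finset.mem_univ, true_and, Units.mulLeft_apply,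
    apply_units_mul hsym]
  refine and_congr_right fun _ => ?_
  rw [huv, mul_assoc, mul_assoc, Units.mul_right_eq_zero]

lemma annihilatedCount_zero_eq (d : ℕ) (m' : ℕ) :
    annihilatedCount w d (0 : Matrix (Fin m) (Fin k) F) =
      annihilatedCount w d (0 : Matrix (Fin m') (Fin k) F) := by
  simp [annihilatedCount]

/-- The Möbius sum of the annihilated counts vanishes if no invertible matrix has weight `d`. -/
lemma sum_mobiusValue_annihilatedCount (hsym : HasMaximalSymmetry w) {d : ℕ}
    (hd : ∀ r : Matrix (Fin k) (Fin k) F, w r = d → r.rank ≠ k)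
    {p : Submodule F (Fin k → F) → Matrix (Fin k) (Fin k) F}
    (hp : ∀ B, LinearMap.range (p B).mulVecLin = B) :
    ∑ B : Submodule F (Fin k → F), mobiusValue (Fintype.card F) (finrank F B) * (annihilatedCount w d (p B) : ℚ) = 0 := by
  classical
  have hcount : ∀ B, (annihilatedCount w d (p B) : ℚ) =
      ∑ r with w r = d, if B ≤ LinearMap.ker r.transpose.mulVecLin then 1 else 0 := by
    intro B
    rw [← annihilatedCount_transpose hsym, annihilatedCount, ← Finset.filter_filter,
      Finset.card_filter]
    push_cast
    refine Finset.sum_congr (by congr) fun r _ => ?_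
    refine if_congr ?_ rfl rfl
    conv_rhs => rw [← hp B]
    rw [LinearMap.range_le_ker_iff, ← Matrix.mulVecLin_mul, ← Matrix.transpose_eq_zero,
      Matrix.transpose_mul, Matrix.transpose_transpose]
    constructor
    · intro h; rw [h, Matrix.mulVecLin_zero]
    · intro h
      rw [← Matrix.toLin'_apply'] at h
      exact (LinearEquiv.map_eq_zero_iff _).1 h
  simp only [hcount, Finset.mul_sum]
  rw [Finset.sum_comm]
  refine Finset.sum_eq_zero fun r hr => ?_
  have h1 := sum_le_mobiusValue_le (⊤ : Submodule F (Fin k → F))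
    (LinearMap.ker r.transpose.mulVecLin)
  simp only [le_top, Finset.filter_true] at h1
  -- The sum for a single `r` is nonzero only if its transpose has trivial kernel, that is, if `r`
  -- has rank `k`.
  rw [h1, if_neg]
  rw [top_disjoint]
  intro hbot
  refine hd r (Finset.mem_filter.1 hr).2 ?_
  have h2 := LinearMap.finrank_range_add_finrank_ker r.transpose.mulVecLin
  rw [hbot, finrank_bot, Module.finrank_fin_fun, add_zero] at h2
  rw [← Matrix.rank_transpose]
  exact h2

lemma sum_mobiusValue_apply_mul (hsym : HasMaximalSymmetry w)
    {p : Submodule F (Fin k → F) → Matrix (Fin k) (Fin k) F}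
    (hp : ∀ B, LinearMap.range (p B).mulVecLin = B) (y : Matrix (Fin k) (Fin k) F)
    [Decidable (LinearMap.ker y.mulVecLin = ⊥)] :
    ∑ B : Submodule F (Fin k → F), mobiusValue (Fintype.card F) (finrank F B) * (w (y * p B) : ℚ) =
      if LinearMap.ker y.mulVecLin = ⊥ then
        altSum (Fintype.card F) (fun l => (rankValue w l : ℚ)) k else 0 := by
  classical
  have h1 := sum_le_mobiusValue_finrank_map (fun l => (rankValue w l : ℚ)) y.mulVecLin ⊤
  simp only [le_top, Finset.filter_true, top_disjoint, finrank_top, Module.finrank_fin_fun] at h1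
  have h2 : ∀ B, w (y * p B) = rankValue w (finrank F (B.map y.mulVecLin)) := fun B => by
    rw [apply_mul_eq_rankValue hsym, hp]
  simp only [h2, h1]

theorem hasSeparatingPair (hk : 0 < k) (hw : IsPositiveWeight w) (hsym : HasMaximalSymmetry w)
    (hnd : IsNondegenerate w) {d : ℕ} (hd : minWeight w ≤ d) (hd2 : d < 2 * minWeight w)
    (hne : (rankSet w d).Nonempty) (hkd : k ∉ rankSet w d) : HasSeparatingPair w d := by
  classical
  by_contra hno
  have hd0 : 0 < d := by omega
  set m := k + (Fintype.card F ^ k) ^ k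
  obtain ⟨c, hc⟩ := exists_survivorCount_eq_mul_sum (m := m) hsym hw hnd hk hd0 hd2 hno le_rfl
  let e : Fin k → Fin m := Fin.castLE (Nat.le_add_right _ _)
  let l : Matrix (Fin m) (Fin k) F := (1 : Matrix (Fin m) (Fin m) F).submatrix id e
  let κ : Matrix (Fin k) (Fin m) F := (1 : Matrix (Fin m) (Fin m) F).submatrix e id
  have hκ : κ * l = 1 := by
    rw [← Matrix.submatrix_mul _ _ _ _ _ Function.bijective_id, mul_one,
      Matrix.submatrix_one _ (Fin.castLE_injective _)]
  choose p hp using fun B : Submodule F (Fin k → F) =>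
    exists_range_mulVecLin_eq (k := k) (B := B) (by simpa using B.finrank_le)
  have hrank : ∀ r : Matrix (Fin k) (Fin k) F, w r = d → r.rank ≠ k := by
    intro r hr hrk
    refine hkd ⟨hk, le_rfl, ?_⟩
    rw [← hr, apply_eq_rankValue hsym, hrk]
  -- The constant `annihilatedCount w d 0` drops out because the Möbius values of all subspaces of
  -- `F^k` sum to zero for `k > 0`.
  have hsurv : ∑ B : Submodule F (Fin k → F), mobiusValue (Fintype.card F) (finrank F B) *
      survivorCount w d (l * p B) = 0 := by
    have h1 := sum_le_mobiusValue_le (⊤ : Submodule F (Fin k → F)) ⊤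
    have : Nonempty (Fin k) := ⟨⟨0, hk⟩⟩
    have htop : (⊤ : Submodule F (Fin k → F)) ≠ ⊥ := top_ne_bot
    simp only [le_top, Finset.filter_true, top_disjoint, if_true, mul_one, htop, if_false] at h1
    simp only [survivorCount, annihilatedCount_mul_left hκ, mul_sub, Finset.sum_sub_distrib,
      ← Finset.sum_mul, h1, zero_mul, sum_mobiusValue_annihilatedCount hsym hrank hp, sub_zero]
  simp only [hc, Finset.mul_sum] at hsurv
  rw [Finset.sum_comm] at hsurv
  have hx : ∀ x : Matrix (Fin k) (Fin m) F, ∑ B : Submodule F (Fin k → F), mobiusValue (Fintype.card F) (finrank F B) *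
      (c * (w (x * (l * p B)) : ℚ)) = c * altSum (Fintype.card F) (fun l => (rankValue w l : ℚ)) k *
        if LinearMap.ker (x * l).mulVecLin = ⊥ then 1 else 0 := by
    intro x
    have h1 := sum_mobiusValue_apply_mul hsym hp (x * l)
    simp only [mul_left_comm _ c, ← Finset.mul_sum, ← Matrix.mul_assoc, h1]
    split_ifs <;> ring
  simp only [hx, ← Finset.mul_sum] at hsurv
  -- This counts the `x` with `x * l` injective; the left inverse `κ` of `l` is one of them.
  have hpos : (0 : ℚ) < ∑ x : Matrix (Fin k) (Fin m) F,
      if LinearMap.ker (x * l).mulVecLin = ⊥ then 1 else 0 := by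
    refine Finset.sum_pos' (fun x _ => by split_ifs <;> norm_num) ⟨κ, Finset.mem_univ _, ?_⟩
    rw [hκ, Matrix.mulVecLin_one, if_pos (LinearMap.ker_id)]
    norm_num
  have hc0 : c = 0 := by
    have h1 := altSum_ne_zero hnd hk le_rfl
    exact (mul_eq_zero.1 ((mul_eq_zero.1 hsurv).resolve_right hpos.ne')).resolve_right h1
  -- With `c = 0`, as many matrices of weight `d` are killed by `l` as by zero. The injective `l`
  -- kills only `r = 0`, of weight `0 < d`, so no matrix has weight `d`.
  have h0 := hc (l * (1 : Matrix (Fin k) (Fin k) F))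
  rw [hc0, zero_mul, survivorCount, annihilatedCount_mul_left hκ, sub_eq_zero,
    annihilatedCount_zero_eq d k] at h0
  have h1 : annihilatedCount w d (1 : Matrix (Fin k) (Fin k) F) = 0 := by
    rw [annihilatedCount, Finset.card_eq_zero, Finset.filter_eq_empty_iff]
    rintro r _ ⟨hr, hr0⟩
    rw [one_mul] at hr0
    rw [hr0, hw.1] at hr
    omega
  rw [h1, Nat.cast_zero, Nat.cast_eq_zero, annihilatedCount, Finset.card_eq_zero,
    Finset.filter_eq_empty_iff] at h0
  obtain ⟨i, _, _, hi⟩ := hne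
  exact h0 (Finset.mem_univ _) ⟨hi, zero_mul _⟩

lemma HasSeparatingPair.not_respectsDuality {d : ℕ} (h : HasSeparatingPair w d) :
    ¬ RespectsDuality w := by
  obtain ⟨n, C, D, hn, hCD, hne⟩ := h
  exact fun hR => hne (weightCount_eq_of_weightEnumerator_eq (hR n hn C D hCD) d)

lemma minWeight_pos_and_rankSet_nonempty (hk : 0 < k) (hw : IsPositiveWeight w)
    (hsym : HasMaximalSymmetry w) :
    0 < minWeight w ∧ (rankSet w (minWeight w)).Nonempty := by
  have : Nonempty (Fin k) := ⟨⟨0, hk⟩⟩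
  obtain ⟨r, hr, hr'⟩ : minWeight w ∈ w '' {r | r ≠ 0} :=
    Nat.sInf_mem ⟨w 1, 1, one_ne_zero, rfl⟩
  refine ⟨hr' ▸ hw.2 r hr, r.rank, ?_, by simpa using r.rank_le_card_width, ?_⟩
  · rw [Nat.one_le_iff_ne_zero]
    intro h0
    apply (hw.2 r hr).ne'
    obtain ⟨u, v, h⟩ := exists_units_mul_mul_eq
      (r := (0 : Matrix (Fin k) (Fin k) F)) (s := r) (by rw [h0, Matrix.rank_zero])
    rw [h, mul_zero, zero_mul, hw.1]
  · rw [← apply_eq_rankValue hsym, hr']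

end Main

end RingCode

theorem mainTheorem4 {F : Type*} [Field F] [Fintype F] {k : ℕ} (hk : 2 ≤ k)
    (w : Matrix (Fin k) (Fin k) F → ℕ) (hw : IsPositiveWeight w)
    (hsym : HasMaximalSymmetry w) (hnd : IsNondegenerate w) :
    (∀ d : ℕ, minWeight w ≤ d → d < 2 * minWeight w → (rankSet w d).Nonempty →
      k ∉ rankSet w d →
        ¬ RespectsDuality w ∧
        ∃ (n : ℕ) (C D : Submodule (Matrix (Fin k) (Fin k) F)
            (Fin n → Matrix (Fin k) (Fin k) F)),
          1 ≤ n ∧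
          weightEnumerator w (C : Set (Fin n → Matrix (Fin k) (Fin k) F)) =
            weightEnumerator w (D : Set (Fin n → Matrix (Fin k) (Fin k) F)) ∧
          weightCount w (dualCode C : Set (Fin n → Matrix (Fin k) (Fin k) F)) d ≠
            weightCount w (dualCode D : Set (Fin n → Matrix (Fin k) (Fin k) F)) d) ∧
    (k ∉ rankSet w (minWeight w) → ¬ RespectsDuality w) := by
  have hk0 : 0 < k := by omega
  refine ⟨fun d hd hd2 hne hkd => ?_, fun hkd => ?_⟩
  · have h := hasSeparatingPair hk0 hw hsym hnd hd hd2 hne hkd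
    exact ⟨h.not_respectsDuality, h⟩
  · obtain ⟨hpos, hne⟩ := minWeight_pos_and_rankSet_nonempty hk0 hw hsym
    exact (hasSeparatingPair hk0 hw hsym hnd le_rfl (by omega) hne hkd).not_respectsDuality
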